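/- Let $M$ be a compact smooth manifold of dimension $m$ without boundary and $N$ a smooth manifold of dimension $n$ without boundary, with local coordinates $(a^\alpha)$ and $(x^i)$. Let $(M,L_M)$ and $(N,L_N)$ be Lagrange spaces of electrodynamics, that is, $$L_M(a,b)=g_{\alpha\beta}(a)b^\alpha b^\beta+g_{\alpha\beta}(a)U^\alpha(a)b^\beta+F(a),\qquad L_N(x,y)=h_{ij}(x)y^iy^j+h_{ij}(x)V^i(x)y^j+G(x),$$ where $g$, $h$ are smooth Riemannian metrics, $U$, $V$ smooth vector fields and $F$, $G$ smooth functions on $M$, $N$ respectively; thus the fundamental tensors $\tfrac12\,\partial^2L_M/\partial b^\alpha\partial b^\beta$ and $\tfrac12\,\partial^2L_N/\partial y^i\partial y^j$ are $g_{\alpha\beta}$ and $h_{ij}$. Let $\varphi_{\alpha\beta}$ be a further smooth Riemannian metric on $M$. Write $G^\gamma_{\alpha\beta}$ and $H^k_{ij}$ for the Christoffel symbols of $g$ and $h$, and set $$\Delta^\gamma_{\alpha\beta}=G^\gamma_{\alpha\beta}+\frac12\,\frac{\partial}{\partial a^\alpha}\Big(\ln\frac{\det(g_{\mu\nu})}{\det(\varphi_{\mu\nu})}\Big)\delta^\gamma_\beta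 ,$$ the components of a linear connection on $M$. A $C^2$ curve $c:J\to M$ on an open interval $J$ is a $(g,\varphi)$-geodesic if in local coordinates $\ddot a^\gamma=-\Delta^\gamma_{\alpha\beta}\dot a^\alpha\dot a^\beta$; an $h$-geodesic is a $C^2$ curve in $N$ with $\ddot x^k=-H^k_{ij}\dot x^i\dot x^j$. **Theorem.** Let $f:M\to N$ be a smooth map such that $f\circ c$ is an $h$-geodesic for every $(g,\varphi)$-geodesic $c$. Then, with $f^k_\alpha=\partial f^k/\partial a^\alpha$ and $f^k_{\alpha\beta}=\partial^2 f^k/\partial a^\alpha\partial a^\beta$, the equations $$g^{\alpha\beta}\big\{f^k_{\alpha\beta}-\Delta^\gamma_{\alpha\beta}f^k_\gamma+H^k_{ij}f^i_\alpha f^j_\beta\big\}=0,\qquad k=1,\dots,n,$$ hold in all local coordinates of $M$ and $N$, and $f$ is harmonic, i.e. a critical point of the energy $$E(f)=\frac12\int_M g^{\alpha\beta}(a)\,h_{ij}(f(a))\,f^i_\alpha f^j_\beta\,\sqrt{\det(\varphi_{\mu\nu})}\;da :$$ for every smooth map $\mathbb R\times M\to N$, $(t,a)\mapsto f_t(a)$,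 with $f_0=f$, the function $t\mapsto E(f_t)$ is differentiable at $t=0$ with derivative $0$. -/

import Mathlib

open Manifold Bundle Set
open scoped ContDiff Matrix

noncomputable section

namespace LagrangeHarmonic

/-- The model space `ℝᵐ`. -/
abbrev Eu (m : ℕ) : Type := EuclideanSpace ℝ (Fin m)

/-- The `α`-th vector of the standard basis of `ℝᵐ`. -/
def stdVec {m : ℕ} (α : Fin m) : Eu m := EuclideanSpace.single α (1 : ℝ)

/-- The partial derivative `∂u/∂p^α` of a real function on `ℝᵐ`. -/
def partialD {m : ℕ} (α : Fin m) (u : Eu m → ℝ) (p : Eu m) : ℝ := fderiv ℝ u p (stdVec α)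

/-- Smooth Riemannian metrics on the `m`-dimensional manifold `M`. -/
abbrev RMetric (m : ℕ) (M : Type*) [TopologicalSpace M] [ChartedSpace (Eu m) M]
    [IsManifold (𝓡 m) ∞ M] : Type _ :=
  ContMDiffRiemannianMetric (𝓡 m) ∞ (Eu m) (fun a : M => TangentSpace (𝓡 m) a)

section Lagrangian

variable (m : ℕ) (M : Type*) [TopologicalSpace M] [ChartedSpace (Eu m) M]
  [IsManifold (𝓡 m) ∞ M]

/-- The data of a Lagrange space of electrodynamics: the gravitational potentials (a Riemannian
metric), the electromagnetic potentials (a smooth vector field) and a smooth potential function. -/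
structure ElectrodynamicsSpace where
  metric : RMetric m M
  vecPot : ∀ a : M, TangentSpace (𝓡 m) a
  vecPot_smooth : ContMDiff (𝓡 m) ((𝓡 m).prod 𝓘(ℝ, Eu m)) ∞
    (fun a => (⟨a, vecPot a⟩ : TangentBundle (𝓡 m) M))
  scalarPot : M → ℝ
  scalarPot_smooth : ContMDiff (𝓡 m) 𝓘(ℝ, ℝ) ∞ scalarPot

variable {m M}

/-- The Lagrangian `L(a, b) = g(b, b) + g(U, b) + F`. -/
def ElectrodynamicsSpace.lagrangian (S : ElectrodynamicsSpace m M) (a : M)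
    (b : TangentSpace (𝓡 m) a) : ℝ :=
  S.metric.inner a b b + S.metric.inner a (S.vecPot a) b + S.scalarPot a

/-- The fundamental tensor `½ ∂²L/∂b∂b` of the Lagrangian, at `(a, b)`, on the vectors `u, v`. -/
def ElectrodynamicsSpace.fundamentalTensor (S : ElectrodynamicsSpace m M) (a : M)
    (b u v : TangentSpace (𝓡 m) a) : ℝ :=
  (1 / 2) * deriv (fun s : ℝ => deriv (fun t : ℝ => S.lagrangian a (b + s • u + t • v)) 0) 0

/-- The fundamental tensor of the Lagrangian of electrodynamics is the metric `g`. -/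
theorem ElectrodynamicsSpace.fundamentalTensor_eq (S : ElectrodynamicsSpace m M) (a : M)
    (b u v : TangentSpace (𝓡 m) a) :
    S.fundamentalTensor a b u v = S.metric.inner a u v := by
  have h1 : ∀ s : ℝ, deriv (fun t : ℝ => S.lagrangian a (b + s • u + t • v)) 0
      = 2 * S.metric.inner a b v + S.metric.inner a (S.vecPot a) v
        + s * (2 * S.metric.inner a u v) := by
    intro s
    have e : (fun t : ℝ => S.lagrangian a (b + s • u + t • v)) = fun t : ℝ =>
        S.lagrangian a (b + s • u) + t * (2 * S.metric.inner a b v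
          + S.metric.inner a (S.vecPot a) v + s * (2 * S.metric.inner a u v))
          + t ^ 2 * S.metric.inner a v v := by
      funext t
      simp only [lagrangian, map_add, map_smul, add_apply,
        _root_.smul_apply, smul_eq_mul,
        S.metric.symm a v b, S.metric.symm a v u, S.metric.symm a u b]
      ring
    rw [e]
    have hd := (((hasDerivAt_id (0 : ℝ)).mul_const (2 * S.metric.inner a b v
          + S.metric.inner a (S.vecPot a) v + s * (2 * S.metric.inner a u v))).const_add
          (S.lagrangian a (b + s • u))).add
          (((hasDerivAt_id (0 : ℝ)).pow 2).mul_const (S.metric.inner a v v))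
    refine hd.deriv.trans ?_
    simp
  unfold fundamentalTensor
  simp only [h1]
  have hd := ((hasDerivAt_id (0 : ℝ)).mul_const (2 * S.metric.inner a u v)).const_add
    (2 * S.metric.inner a b v + S.metric.inner a (S.vecPot a) v)
  refine (congrArg (fun x : ℝ => 1 / 2 * x) hd.deriv).trans ?_
  ring

end Lagrangian

section Coordinates

variable {m : ℕ} {M : Type*} [TopologicalSpace M] [ChartedSpace (Eu m) M]
  [IsManifold (𝓡 m) ∞ M]

/-- The charts of the smooth manifold `M`. -/
def IsChart (e : OpenPartialHomeomorph M (Eu m)) : Prop :=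
  e ∈ IsManifold.maximalAtlas (𝓡 m) ∞ M

/-- The coordinate vector `∂/∂a^α` of the chart `e`, at the point with coordinates `p`. -/
def coordVec (e : OpenPartialHomeomorph M (Eu m)) (p : Eu m) (α : Fin m) :
    TangentSpace (𝓡 m) (e.symm p) :=
  mfderiv (𝓡 m) (𝓡 m) e.symm p (stdVec α)

/-- The matrix `(g_{αβ}(p))` of the metric `g` in the chart `e`. -/
def metricMatrix (g : RMetric m M) (e : OpenPartialHomeomorph M (Eu m)) (p : Eu m) :
    Matrix (Fin m) (Fin m) ℝ :=
  Matrix.of fun α β => g.inner (e.symm p) (coordVec e p α) (coordVec e p β)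

/-- The Christoffel symbol `G^γ_{αβ}(p)` of the metric `g` in the chart `e`. -/
def christoffel (g : RMetric m M) (e : OpenPartialHomeomorph M (Eu m)) (γ α β : Fin m)
    (p : Eu m) : ℝ :=
  (1 / 2) * ∑ σ, (metricMatrix g e p)⁻¹ γ σ *
    (partialD α (fun q => metricMatrix g e q σ β) p
      + partialD β (fun q => metricMatrix g e q σ α) p
      - partialD σ (fun q => metricMatrix g e q α β) p)

/-- The component `Δ^γ_{αβ} = G^γ_{αβ} + ½ ∂_α(ln(g/φ)) δ^γ_β` of the connection induced by the
metrics `g` and `φ`. -/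
def deltaSymbol (g φ : RMetric m M) (e : OpenPartialHomeomorph M (Eu m)) (γ α β : Fin m)
    (p : Eu m) : ℝ :=
  christoffel g e γ α β p
    + (1 / 2) * partialD α
        (fun q => Real.log ((metricMatrix g e q).det / (metricMatrix φ e q).det)) p
      * (if γ = β then 1 else 0)

/-- The `α`-th coordinate `a^α(t)` of the curve `c` in the chart `e`. -/
def curveCoord (e : OpenPartialHomeomorph M (Eu m)) (c : ℝ → M) (α : Fin m) (t : ℝ) : ℝ :=
  e (c t) α

/-- The curve `c`, of class `C²` on the open interval `J`, is autoparallel for the connection whose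
symbols in the chart `e` are `D e γ α β`: in every chart,
`d²a^γ/dt² = - D^γ_{αβ} (da^α/dt) (da^β/dt)`. -/
def IsAutoparallel (D : OpenPartialHomeomorph M (Eu m) → Fin m → Fin m → Fin m → Eu m → ℝ)
    (c : ℝ → M) (J : Set ℝ) : Prop :=
  ContMDiffOn 𝓘(ℝ, ℝ) (𝓡 m) 2 c J ∧
    ∀ e : OpenPartialHomeomorph M (Eu m), IsChart e → ∀ t ∈ J, c t ∈ e.source → ∀ γ : Fin m,
      deriv (deriv (curveCoord e c γ)) t
        = -∑ α, ∑ β, D e γ α β (e (c t))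
            * deriv (curveCoord e c α) t * deriv (curveCoord e c β) t

/-- Geodesics of the Riemannian metric `h`. -/
def IsGeodesic (h : RMetric m M) (c : ℝ → M) (J : Set ℝ) : Prop :=
  IsAutoparallel (christoffel h) c J

/-- `(g, φ)`-geodesics: autoparallel curves of the connection induced by `g` and `φ`. -/
def IsPairGeodesic (g φ : RMetric m M) (c : ℝ → M) (J : Set ℝ) : Prop :=
  IsAutoparallel (deltaSymbol g φ) c J

end Coordinates

section Integration

variable {m : ℕ} {M : Type*} [TopologicalSpace M] [ChartedSpace (Eu m) M]
  [IsManifold (𝓡 m) ∞ M] [T2Space M] [CompactSpace M]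

variable (m M) in
/-- A smooth partition of unity `(ρ_x)` of `M`, with `ρ_x` supported in the domain of the
preferred chart at `x`; only finitely many `ρ_x` are nonzero, as `M` is compact. -/
def partitionOfUnity : SmoothPartitionOfUnity M (𝓡 m) M univ :=
  (SmoothPartitionOfUnity.exists_isSubordinate_chartAt_source (𝓡 m) M).choose

variable (m M) in
theorem partitionOfUnity_isSubordinate :
    (partitionOfUnity m M).IsSubordinate (fun x => (chartAt (Eu m) x).source) :=
  (SmoothPartitionOfUnity.exists_isSubordinate_chartAt_source (𝓡 m) M).choose_spec

/-- The integral `∫_M u √φ da` of the continuous function `u` for the Riemannian volume of `φ`: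
`∑_x ∫ ρ_x u √(det φ_{αβ}) da`, each term being computed in the chart at `x`. -/
def volIntegral (φ : RMetric m M) (u : M → ℝ) : ℝ :=
  ∑ᶠ x : M, ∫ p in (chartAt (Eu m) x).target,
    partitionOfUnity m M x ((chartAt (Eu m) x).symm p) * u ((chartAt (Eu m) x).symm p)
      * Real.sqrt (metricMatrix φ (chartAt (Eu m) x) p).det

end Integration

section Maps

variable {m n : ℕ} {M : Type*} [TopologicalSpace M] [ChartedSpace (Eu m) M]
  [IsManifold (𝓡 m) ∞ M] {N : Type*} [TopologicalSpace N] [ChartedSpace (Eu n) N]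
  [IsManifold (𝓡 n) ∞ N]

/-- The basis of the tangent space at `a` given by the preferred chart at `a`. -/
def tangentVec (a : M) (α : Fin m) : TangentSpace (𝓡 m) a :=
  (stdVec α : Eu m)

/-- The Gram matrix of `g` at `a`. -/
def gramMatrix (g : RMetric m M) (a : M) : Matrix (Fin m) (Fin m) ℝ :=
  Matrix.of fun α β => g.inner a (tangentVec a α) (tangentVec a β)

/-- The function `g^{αβ} h_{ij} f^i_α f^j_β` on `M`, that is the trace of `f^* h` with respect
to `g`. It is computed in the basis `tangentVec a` of the tangent space, and would be the same in
any other basis. -/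
def energyDensity (g : RMetric m M) (h : RMetric n N) (f : M → N) (a : M) : ℝ :=
  ∑ α, ∑ β, (gramMatrix g a)⁻¹ α β *
    h.inner (f a) (mfderiv (𝓡 m) (𝓡 n) f a (tangentVec a α))
      (mfderiv (𝓡 m) (𝓡 n) f a (tangentVec a β))

/-- The energy functional `E(f) = ½ ∫_M g^{αβ} h_{ij} f^i_α f^j_β √φ da`. -/
def energy [T2Space M] [CompactSpace M] (g φ : RMetric m M) (h : RMetric n N) (f : M → N) : ℝ :=
  (1 / 2) * volIntegral φ (energyDensity g h f)

/-- The smooth map `f` is harmonic: it is a critical point of the energy, that is, along every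
smooth variation `F t` of `f = F 0` the derivative of the energy at `t = 0` exists and is zero. -/
def IsHarmonic [T2Space M] [CompactSpace M] (g φ : RMetric m M) (h : RMetric n N)
    (f : M → N) : Prop :=
  ContMDiff (𝓡 m) (𝓡 n) ∞ f ∧
    ∀ F : ℝ → M → N,
      ContMDiff (𝓘(ℝ, ℝ).prod (𝓡 m)) (𝓡 n) ∞ (fun z : ℝ × M => F z.1 z.2) → F 0 = f →
      HasDerivAt (fun t => energy g φ h (F t)) 0 0

/-- The `k`-th coordinate `f^k` of the map `f` in the charts `e` of `M` and `e'` of `N`. -/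
def mapCoord (e : OpenPartialHomeomorph M (Eu m)) (e' : OpenPartialHomeomorph N (Eu n))
    (f : M → N) (k : Fin n) (p : Eu m) : ℝ :=
  e' (f (e.symm p)) k

/-- The equations of harmonic maps, in all charts `e` of `M` and `e'` of `N`:
`g^{αβ} (f^k_{αβ} - Δ^γ_{αβ} f^k_γ + H^k_{ij} f^i_α f^j_β) = 0` for every `k`. -/
def HarmonicMapEquations (g φ : RMetric m M) (h : RMetric n N) (f : M → N) : Prop :=
  ∀ e : OpenPartialHomeomorph M (Eu m), IsChart e →
    ∀ e' : OpenPartialHomeomorph N (Eu n), IsChart e' →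
      ∀ p ∈ e.target, f (e.symm p) ∈ e'.source → ∀ k : Fin n,
        ∑ α, ∑ β, (metricMatrix g e p)⁻¹ α β *
          (partialD α (partialD β (mapCoord e e' f k)) p
            - ∑ γ, deltaSymbol g φ e γ α β p * partialD γ (mapCoord e e' f k) p
            + ∑ i, ∑ j, christoffel h e' k i j (e' (f (e.symm p)))
                * partialD α (mapCoord e e' f i) p * partialD β (mapCoord e e' f j) p) = 0

end Maps

end LagrangeHarmonic

end

set_option maxSynthPendingDepth 3
set_option linter.unusedSectionVars false

noncomputable section

namespace LagrangeHarmonic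

/-! ### Derivatives of determinants and inverse matrices. -/

section MatrixCalculus

variable {E : Type*} [NormedAddCommGroup E] [NormedSpace ℝ E] {m : ℕ}

/-! The equations come from geodesics. Through each point of `M` and in each direction `b` there is
a `(g, φ)`-geodesic (`exists_isPairGeodesic`). Its image is an `h`-geodesic, and comparing
accelerations at time zero shows that the form `∇df(u, v) = D²f(u, v) - Df(Δ(u, v)) + H(Df u, Df v)`
vanishes for `u = v = b` (`second_fundamental_form_eq_zero`). Since `Δ` need not be symmetric,
polarization only makes `∇df` antisymmetric; its trace against the symmetric matrix `g⁻¹` is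
nevertheless zero (`tension_eq_zero`). This trace is the tension field, whose components are the
left sides of the equations.

Harmonicity follows because the logarithmic term of `Δ` is the one adapted to the weight `√φ`: `√φ
g^{αγ} Δ^β_{αγ} = -∂_α(√φ g^{αβ})` (`sum_partialD_volDensity_mul_inv`). Let `W` be the variation
field. Expanding `h(W, ∇df)` by the Koszul formula and using the symmetry of second derivatives, one
finds that wherever the tension vanishes, `½ √φ` times the time derivative of the energy density is
the coordinate divergence of `√φ g^{αβ} h(W, f_β)` (`sum_partialD_flux`).

It remains to integrate a divergence over `M`, with integrals defined by a partition of unity `ρ_x`.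
Integration by parts in the chart at `x` moves the derivatives onto `ρ_x`. The resulting functions
`g^{αβ} ∂_α ρ_x h(W, f_β)` are globally defined and sum to zero, because the `ρ_x` sum to one. As
they are integrated in different charts, `sum_integral_chart_eq_zero` first refines them by a second
copy of the partition and changes variables. -/

theorem contDiffAt_det {k : WithTop ℕ∞} {A : E → Matrix (Fin m) (Fin m) ℝ} {p : E}
    (hA : ∀ i j, ContDiffAt ℝ k (fun q => A q i j) p) :
    ContDiffAt ℝ k (fun q => (A q).det) p := by
  simp only [Matrix.det_apply]
  refine ContDiffAt.sum fun σ _ => ContDiffAt.const_smul _ ?_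
  exact contDiffAt_prod fun i _ => hA _ _

theorem contDiffAt_inv {k : WithTop ℕ∞} {A : E → Matrix (Fin m) (Fin m) ℝ} {p : E}
    (hA : ∀ i j, ContDiffAt ℝ k (fun q => A q i j) p) (h0 : (A p).det ≠ 0) (i j : Fin m) :
    ContDiffAt ℝ k (fun q => (A q)⁻¹ i j) p := by
  simp only [Matrix.inv_def, Matrix.smul_apply, Ring.inverse_eq_inv', smul_eq_mul,
    Matrix.adjugate_apply]
  refine ((contDiffAt_det hA).inv h0).mul (contDiffAt_det fun a b => ?_)
  simp only [Matrix.updateRow_apply]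
  split_ifs
  · exact contDiffAt_const
  · exact hA a b

/-- Jacobi's formula for the derivative at the identity, along a line. -/
theorem hasDerivAt_det_one_add_smul (X : Matrix (Fin m) (Fin m) ℝ) :
    HasDerivAt (fun t : ℝ => (1 + t • X).det) X.trace 0 := by
  -- The determinant is the evaluation at `t` of a polynomial whose derivative at `0` is the trace.
  have h := (Matrix.det (1 + (Polynomial.X : Polynomial ℝ) • X.map Polynomial.C)).hasDerivAt 0
  rw [Matrix.derivative_det_one_add_X_smul] at h
  refine h.congr_of_eventuallyEq (Filter.Eventually.of_forall fun t => ?_)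
  simp only []
  rw [← Polynomial.coe_evalRingHom, RingHom.map_det]
  congr 1
  ext i j
  by_cases hij : i = j <;> simp [hij, mul_comm t]

/-- Jacobi's formula. -/
theorem fderiv_det {A : E → Matrix (Fin m) (Fin m) ℝ} {p : E}
    (hA : ∀ i j, DifferentiableAt ℝ (fun q => A q i j) p) (h0 : (A p).det ≠ 0) (v : E) :
    fderiv ℝ (fun q => (A q).det) p v
      = (A p).det * ∑ i, ∑ j, (A p)⁻¹ i j * fderiv ℝ (fun q => A q j i) p v := by
  set X : Matrix (Fin m) (Fin m) ℝ := Matrix.of fun i j => fderiv ℝ (fun q => A q i j) p v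
    with hX
  have hd : DifferentiableAt ℝ (fun B : Fin m → Fin m → ℝ => (Matrix.of B).det)
      (fun i j => A p i j) := by
    have : ContDiffAt ℝ 1 (fun B : Fin m → Fin m → ℝ => (Matrix.of B).det)
        (fun i j => A p i j) :=
      contDiffAt_det fun i j => by simp only [Matrix.of_apply]; fun_prop
    exact this.differentiableAt one_ne_zero
  have hA' : HasFDerivAt (fun q => fun i j => A q i j)
      (ContinuousLinearMap.pi fun i => ContinuousLinearMap.pi fun j =>
        fderiv ℝ (fun q => A q i j) p) p := by
    rw [hasFDerivAt_pi]
    intro i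
    rw [hasFDerivAt_pi]
    exact fun j => (hA i j).hasFDerivAt
  have h1 := (hd.hasFDerivAt.comp p hA').fderiv
  have h2 : fderiv ℝ (fun q => (A q).det) p v
      = fderiv ℝ (fun B : Fin m → Fin m → ℝ => (Matrix.of B).det) (fun i j => A p i j)
        (fun i j => X i j) := by
    change fderiv ℝ ((fun B : Fin m → Fin m → ℝ => (Matrix.of B).det) ∘
      fun q => fun i j => A q i j) p v = _
    rw [h1]; rfl
  -- The derivative of `det` in the direction `X` is read along the line `A p + t X` in two ways: by
  -- the chain rule, and from the factorization `det (A p) * det (1 + t (A p)⁻¹ X)`.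
  have hline : HasDerivAt
      (fun t : ℝ => (fun i j => A p i j) + t • (fun i j => X i j : Fin m → Fin m → ℝ))
      (fun i j => X i j) 0 := by
    simpa using ((hasDerivAt_id (0 : ℝ)).smul_const
      (fun i j => X i j : Fin m → Fin m → ℝ)).const_add (fun i j => A p i j)
  have h3 : HasDerivAt (fun t : ℝ => (A p + t • X).det)
      (fderiv ℝ (fun B : Fin m → Fin m → ℝ => (Matrix.of B).det) (fun i j => A p i j)
        (fun i j => X i j)) 0 := by
    have hd' : HasFDerivAt (fun B : Fin m → Fin m → ℝ => (Matrix.of B).det)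
      (fderiv ℝ (fun B : Fin m → Fin m → ℝ => (Matrix.of B).det) (fun i j => A p i j))
      ((fun i j => A p i j) + (0 : ℝ) • (fun i j => X i j : Fin m → Fin m → ℝ)) := by
        simpa using hd.hasFDerivAt
    exact hd'.comp_hasDerivAt (0 : ℝ) hline
  have h4 : HasDerivAt (fun t : ℝ => (A p + t • X).det)
      ((A p).det * ((A p)⁻¹ * X).trace) 0 := by
    have := (hasDerivAt_det_one_add_smul ((A p)⁻¹ * X)).const_mul (A p).det
    refine this.congr_of_eventuallyEq (Filter.Eventually.of_forall fun t => ?_)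
    simp only [← Matrix.det_mul, Matrix.mul_add, Matrix.mul_one, Matrix.mul_smul]
    rw [Matrix.mul_nonsing_inv_cancel_left _ _ (isUnit_iff_ne_zero.2 h0)]
  rw [h2, h3.unique h4]
  simp [Matrix.trace, Matrix.mul_apply, hX]

/-- Differentiate `A⁻¹ A = 1`, which holds near `p` because the determinant stays nonzero there, and
solve by multiplying with `A⁻¹` on the right. -/
theorem fderiv_inv_apply {A : E → Matrix (Fin m) (Fin m) ℝ} {p : E}
    (hA : ∀ i j, ContDiffAt ℝ 1 (fun q => A q i j) p) (h0 : (A p).det ≠ 0) (v : E)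
    (i j : Fin m) :
    fderiv ℝ (fun q => (A q)⁻¹ i j) p v
      = -∑ k, ∑ l, (A p)⁻¹ i k * fderiv ℝ (fun q => A q k l) p v * (A p)⁻¹ l j := by
  have hdA : ∀ i j, DifferentiableAt ℝ (fun q => A q i j) p :=
    fun i j => (hA i j).differentiableAt one_ne_zero
  have hdI : ∀ i j, DifferentiableAt ℝ (fun q => (A q)⁻¹ i j) p :=
    fun i j => (contDiffAt_inv hA h0 i j).differentiableAt one_ne_zero
  set X : Matrix (Fin m) (Fin m) ℝ := Matrix.of fun i j => fderiv ℝ (fun q => A q i j) p v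
    with hX
  set Y : Matrix (Fin m) (Fin m) ℝ := Matrix.of fun i j => fderiv ℝ (fun q => (A q)⁻¹ i j) p v
    with hY
  have hne : ∀ᶠ q in nhds p, (A q).det ≠ 0 :=
    (contDiffAt_det hA).continuousAt.eventually_ne h0
  have key : Y * A p + (A p)⁻¹ * X = 0 := by
    ext a b
    have h1 : fderiv ℝ (fun q => ∑ k, (A q)⁻¹ a k * A q k b) p = 0 := by
      have : (fun q => ∑ k, (A q)⁻¹ a k * A q k b) =ᶠ[nhds p]
          fun _ => (1 : Matrix (Fin m) (Fin m) ℝ) a b := by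
        filter_upwards [hne] with q hq
        rw [← Matrix.nonsing_inv_mul _ (isUnit_iff_ne_zero.2 hq), Matrix.mul_apply]
      rw [this.fderiv_eq]; simp
    rw [fderiv_fun_sum fun k _ => (hdI a k).fun_mul (hdA k b)] at h1
    have h2 := congrArg (fun L => L v) h1
    simp only [_root_.sum_apply, _root_.zero_apply, fderiv_fun_mul (hdI _ _) (hdA _ _),
      _root_.add_apply, _root_.smul_apply, smul_eq_mul, Finset.sum_add_distrib] at h2
    simp only [Matrix.add_apply, Matrix.mul_apply, hX, hY, Matrix.of_apply, Matrix.zero_apply]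
    rw [← h2, add_comm]
    congr 1
    exact Finset.sum_congr rfl fun k _ => mul_comm _ _
  have hYe : Y = -((A p)⁻¹ * X * (A p)⁻¹) := by
    have := congrArg (fun Z => Z * (A p)⁻¹) key
    simp only [Matrix.add_mul, Matrix.zero_mul] at this
    rw [Matrix.mul_nonsing_inv_cancel_right _ _ (isUnit_iff_ne_zero.2 h0)] at this
    exact eq_neg_of_add_eq_zero_left this
  have := congrFun (congrFun hYe i) j
  simp only [hY, Matrix.of_apply, Matrix.neg_apply, Matrix.mul_apply] at this
  rw [this, Finset.sum_comm]
  simp [hX, Finset.sum_mul]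

end MatrixCalculus

/-! ### Change of basis for bilinear forms. -/

section Frames

variable {m : ℕ}

theorem sum_smul_stdVec (v : Eu m) : ∑ i, v i • (stdVec i : Eu m) = v := by
  have := (EuclideanSpace.basisFun (Fin m) ℝ).sum_repr v
  simpa [stdVec] using this

theorem stdVec_apply (i j : Fin m) : (stdVec i : Eu m) j = if j = i then 1 else 0 := by
  simp [stdVec]

theorem clm_eq_sum {F : Type*} [NormedAddCommGroup F] [NormedSpace ℝ F] (L : Eu m →L[ℝ] F)
    (v : Eu m) : L v = ∑ i, v i • L (stdVec i) := by
  conv_lhs => rw [← sum_smul_stdVec v]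
  simp

theorem bilin_eq_sum {F : Type*} [NormedAddCommGroup F] [NormedSpace ℝ F]
    (B : Eu m →L[ℝ] Eu m →L[ℝ] F) (v w : Eu m) :
    B v w = ∑ i, ∑ j, (v i * w j) • B (stdVec i) (stdVec j) := by
  rw [clm_eq_sum B v]
  simp only [_root_.sum_apply, _root_.smul_apply]
  refine Finset.sum_congr rfl fun i _ => ?_
  rw [clm_eq_sum (B (stdVec i)) w, Finset.smul_sum]
  simp [mul_smul]

/-- The matrix of a bilinear form on the images under `D` of the standard basis. -/
def formMatrix (B : Eu m →L[ℝ] Eu m →L[ℝ] ℝ) (D : Eu m →L[ℝ] Eu m) :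
    Matrix (Fin m) (Fin m) ℝ :=
  Matrix.of fun i j => B (D (stdVec i)) (D (stdVec j))

/-- The matrix whose rows are the images under `D` of the standard basis. -/
def frameMatrix (D : Eu m →L[ℝ] Eu m) : Matrix (Fin m) (Fin m) ℝ :=
  Matrix.of fun i j => D (stdVec i) j

theorem formMatrix_eq (B : Eu m →L[ℝ] Eu m →L[ℝ] ℝ) (D : Eu m →L[ℝ] Eu m) :
    formMatrix B D
      = frameMatrix D * formMatrix B (ContinuousLinearMap.id ℝ _) * (frameMatrix D)ᵀ := by
  ext i j
  simp only [formMatrix, frameMatrix, Matrix.mul_apply, Matrix.of_apply, Matrix.transpose_apply,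
    ContinuousLinearMap.id_apply]
  rw [bilin_eq_sum, Finset.sum_comm]
  refine Finset.sum_congr rfl fun k _ => ?_
  rw [Finset.sum_mul]
  refine Finset.sum_congr rfl fun l _ => ?_
  simp; ring

/-- Image vectors are stored as rows, so composition of maps reverses into matrix multiplication. -/
theorem frameMatrix_mul {D D' : Eu m →L[ℝ] Eu m} (h : ∀ v, D (D' v) = v) :
    frameMatrix D' * frameMatrix D = 1 := by
  ext i j
  have := congrArg (fun v : Eu m => v j) ((clm_eq_sum D (D' (stdVec i))).symm.trans (h _))
  simp only [Matrix.mul_apply, frameMatrix, Matrix.of_apply, Matrix.one_apply]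
  simpa [stdVec_apply, eq_comm] using this

theorem det_frameMatrix (D : Eu m →L[ℝ] Eu m) :
    (frameMatrix D).det = D.det := by
  have : frameMatrix D = (LinearMap.toMatrix (EuclideanSpace.basisFun (Fin m) ℝ).toBasis
      (EuclideanSpace.basisFun (Fin m) ℝ).toBasis (D : Eu m →ₗ[ℝ] Eu m))ᵀ := by
    ext i j
    simp [frameMatrix, LinearMap.toMatrix_apply, stdVec]
  rw [this, Matrix.det_transpose, LinearMap.det_toMatrix]

theorem det_formMatrix (B : Eu m →L[ℝ] Eu m →L[ℝ] ℝ) (D : Eu m →L[ℝ] Eu m) :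
    (formMatrix B D).det
      = D.det ^ 2 * (formMatrix B (ContinuousLinearMap.id ℝ _)).det := by
  rw [formMatrix_eq, Matrix.det_mul, Matrix.det_mul, Matrix.det_transpose, det_frameMatrix]
  ring

/-- The trace of a bilinear form with respect to another one does not depend on the basis. -/
theorem sum_inv_formMatrix {D D' : Eu m →L[ℝ] Eu m} (h : ∀ v, D (D' v) = v)
    (B A : Eu m →L[ℝ] Eu m →L[ℝ] ℝ) :
    ∑ i, ∑ j, (formMatrix B D)⁻¹ i j * formMatrix A D i j
      = ∑ i, ∑ j, (formMatrix B (ContinuousLinearMap.id ℝ _))⁻¹ i j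
        * formMatrix A (ContinuousLinearMap.id ℝ _) i j := by
  have htr : ∀ X Y : Matrix (Fin m) (Fin m) ℝ, ∑ i, ∑ j, X i j * Y i j = (X * Yᵀ).trace := by
    intro X Y; simp [Matrix.trace, Matrix.mul_apply]
  have hQP := frameMatrix_mul h
  have hPQ : frameMatrix D * frameMatrix D' = 1 := mul_eq_one_comm.1 hQP
  have hPi : (frameMatrix D)⁻¹ = frameMatrix D' := Matrix.inv_eq_left_inv hQP
  rw [htr, htr, formMatrix_eq B D, formMatrix_eq A D, Matrix.mul_inv_rev, Matrix.mul_inv_rev,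
    ← Matrix.transpose_nonsing_inv, hPi, Matrix.transpose_mul, Matrix.transpose_mul,
    Matrix.transpose_transpose]
  set P := frameMatrix D
  set Q := frameMatrix D'
  set G := formMatrix B (ContinuousLinearMap.id ℝ _)
  set C := formMatrix A (ContinuousLinearMap.id ℝ _)
  -- The inner pair `Q P` cancels directly; the outer factors `Qᵀ` and `Pᵀ` meet only by cyclicity
  -- of the trace.
  have e : Qᵀ * (G⁻¹ * Q) * (P * (Cᵀ * Pᵀ)) = Qᵀ * ((G⁻¹ * Cᵀ) * Pᵀ) := by
    calc _ = Qᵀ * (G⁻¹ * ((Q * P) * (Cᵀ * Pᵀ))) := by simp only [Matrix.mul_assoc]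
      _ = _ := by rw [hQP, Matrix.one_mul]; simp only [Matrix.mul_assoc]
  rw [e, Matrix.trace_mul_comm, Matrix.mul_assoc, ← Matrix.transpose_mul, hQP,
    Matrix.transpose_one, Matrix.mul_one]

end Frames

/-! ### Metrics, maps and coordinate changes in charts. -/

section Charts

variable {m n : ℕ} {M : Type*} [TopologicalSpace M] [ChartedSpace (Eu m) M]
  [IsManifold (𝓡 m) ∞ M] {N : Type*} [TopologicalSpace N] [ChartedSpace (Eu n) N]
  [IsManifold (𝓡 n) ∞ N]

/-- The metric at `a`, as a bilinear form on the model space. -/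
def innerForm (g : RMetric m M) (a : M) : Eu m →L[ℝ] Eu m →L[ℝ] ℝ := g.inner a

/-- The frame of coordinate vectors of the chart `e`, as a linear map. -/
def chartFrame (e : OpenPartialHomeomorph M (Eu m)) (p : Eu m) : Eu m →L[ℝ] Eu m :=
  mfderiv (𝓡 m) (𝓡 m) e.symm p

/-- The metric in the chart `e`, as a bilinear form on the model space. -/
def metricForm (g : RMetric m M) (e : OpenPartialHomeomorph M (Eu m)) (p : Eu m) :
    Eu m →L[ℝ] Eu m →L[ℝ] ℝ :=
  (innerForm g (e.symm p)).bilinearComp (chartFrame e p) (chartFrame e p)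

theorem metricForm_apply (g : RMetric m M) (e : OpenPartialHomeomorph M (Eu m)) (p u v : Eu m) :
    metricForm g e p u v = innerForm g (e.symm p) (chartFrame e p u) (chartFrame e p v) := rfl

theorem metricMatrix_apply (g : RMetric m M) (e : OpenPartialHomeomorph M (Eu m)) (p : Eu m)
    (i j : Fin m) : metricMatrix g e p i j = metricForm g e p (stdVec i) (stdVec j) := rfl

theorem isChart_chartAt (x : M) : IsChart (chartAt (Eu m) x) :=
  IsManifold.chart_mem_maximalAtlas x

variable {e : OpenPartialHomeomorph M (Eu m)} {p : Eu m}

theorem IsChart.contMDiffAt (he : IsChart e) {a : M} (ha : a ∈ e.source) :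
    ContMDiffAt (𝓡 m) (𝓡 m) ∞ e a :=
  contMDiffAt_of_mem_maximalAtlas he ha

theorem IsChart.contMDiffAt_symm (he : IsChart e) (hp : p ∈ e.target) :
    ContMDiffAt (𝓡 m) (𝓡 m) ∞ e.symm p :=
  contMDiffAt_symm_of_mem_maximalAtlas he hp

/-- The tangent map of the inverse chart is smooth and is applied here to a constant section.
Feeding these sections to the metric gives smooth coefficients. -/
theorem IsChart.contMDiffAt_symm_tangent (he : IsChart e) (hp : p ∈ e.target) (u : Eu m) :
    ContMDiffAt (𝓡 m) ((𝓡 m).prod 𝓘(ℝ, Eu m)) ∞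
      (fun q => (⟨e.symm q, chartFrame e q u⟩ : TangentBundle (𝓡 m) M)) p := by
  have h1 := (contMDiffOn_symm_of_mem_maximalAtlas he).contMDiffOn_tangentMapWithin
    (m := ∞) (n := ∞) le_rfl e.open_target.uniqueMDiffOn
  have h2 : ContMDiff (𝓡 m) ((𝓡 m).prod 𝓘(ℝ, Eu m)) ∞
      (fun q : Eu m => (⟨q, u⟩ : TangentBundle (𝓡 m) (Eu m))) := by
    intro q
    rw [contMDiffAt_totalSpace]
    refine ⟨contMDiffAt_id, ?_⟩
    simp
    exact contMDiffAt_const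
  have h3 := (h1.comp (h2.contMDiffOn (s := e.target)) fun q hq => hq).contMDiffAt
    (e.open_target.mem_nhds hp)
  suffices h5 : (fun q => (⟨e.symm q, chartFrame e q u⟩ : TangentBundle (𝓡 m) M)) =ᶠ[nhds p]
      (tangentMapWithin (𝓡 m) (𝓡 m) e.symm e.target ∘
        fun q => (⟨q, u⟩ : TangentBundle (𝓡 m) (Eu m))) from h3.congr_of_eventuallyEq h5
  filter_upwards [e.open_target.mem_nhds hp] with q hq
  have h4 : mfderivWithin (𝓡 m) (𝓡 m) e.symm e.target q = mfderiv (𝓡 m) (𝓡 m) e.symm q :=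
    mfderivWithin_of_isOpen e.open_target hq
  exact congrArg (fun L : Eu m →L[ℝ] Eu m => (⟨e.symm q, L u⟩ : TangentBundle (𝓡 m) M)) h4.symm

theorem IsChart.contDiffAt_metricForm_apply (he : IsChart e) (g : RMetric m M) (hp : p ∈ e.target)
    (u v : Eu m) : ContDiffAt ℝ ∞ (fun q => metricForm g e q u v) p := by
  have h1 : ContMDiffAt (𝓡 m) ((𝓡 m).prod 𝓘(ℝ, Eu m →L[ℝ] Eu m →L[ℝ] ℝ)) ∞
      (fun q => TotalSpace.mk' (Eu m →L[ℝ] Eu m →L[ℝ] ℝ)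
        (E := fun a : M => (TangentSpace (𝓡 m) a →L[ℝ] TangentSpace (𝓡 m) a →L[ℝ] ℝ))
        (e.symm q) (g.inner (e.symm q))) p :=
    (g.contMDiff _).comp p (he.contMDiffAt_symm hp)
  have h2 := ContMDiffAt.clm_bundle_apply₂ (E₃ := fun _ : M => ℝ) (F₃ := ℝ) h1
    (he.contMDiffAt_symm_tangent hp u) (he.contMDiffAt_symm_tangent hp v)
  simp only [contMDiffAt_totalSpace] at h2
  exact h2.2.contDiffAt

/-- In finite dimension an operator-valued map is smooth once its values on fixed vectors are. -/
theorem IsChart.contDiffAt_metricForm (he : IsChart e) (g : RMetric m M) (hp : p ∈ e.target) :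
    ContDiffAt ℝ ∞ (metricForm g e) p := by
  have h : ContDiffOn ℝ ∞ (metricForm g e) e.target := by
    rw [contDiffOn_clm_apply]
    intro u
    rw [contDiffOn_clm_apply]
    exact fun v q hq => (he.contDiffAt_metricForm_apply g hq u v).contDiffWithinAt
  exact h.contDiffAt (e.open_target.mem_nhds hp)

theorem innerForm_pos (g : RMetric m M) (a : M) {u : Eu m} (hu : u ≠ 0) :
    0 < innerForm g a u u := g.pos a u hu

theorem metricForm_symm (g : RMetric m M) (e : OpenPartialHomeomorph M (Eu m)) (p u v : Eu m) :
    metricForm g e p u v = metricForm g e p v u := g.symm _ _ _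

/-- The derivative of a map between manifolds, as a linear map of the model spaces. -/
def mapDeriv (f : M → N) (a : M) : Eu m →L[ℝ] Eu n := mfderiv (𝓡 m) (𝓡 n) f a

/-- The map `f` in the charts `e` and `e'`. -/
def mapIn (e : OpenPartialHomeomorph M (Eu m)) (e' : OpenPartialHomeomorph N (Eu n))
    (f : M → N) (p : Eu m) : Eu n := e' (f (e.symm p))

/-- Near `p` the map `f ∘ e.symm` also factors as `e'.symm` after the coordinate expression of `f`;
the chain rule is applied to both factorizations. -/
theorem mapDeriv_chartFrame {e' : OpenPartialHomeomorph N (Eu n)} (he : IsChart e)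
    (he' : IsChart e') {f : M → N} (hp : p ∈ e.target) (hf : ContMDiffAt (𝓡 m) (𝓡 n) ∞ f (e.symm p))
    (hfp : f (e.symm p) ∈ e'.source) (u : Eu m) :
    mapDeriv f (e.symm p) (chartFrame e p u)
      = chartFrame e' (mapIn e e' f p) (fderiv ℝ (mapIn e e' f) p u) := by
  have h0 : (∞ : WithTop ℕ∞) ≠ 0 := by simp
  have hs := (he.contMDiffAt_symm hp).mdifferentiableAt h0
  have hfd := hf.mdifferentiableAt h0
  have he'd := (he'.contMDiffAt hfp).mdifferentiableAt h0
  have ht : mapIn e e' f p ∈ e'.target := e'.map_source hfp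
  have hs' := (he'.contMDiffAt_symm ht).mdifferentiableAt h0
  have hc : MDifferentiableAt (𝓡 m) (𝓡 n) (f ∘ e.symm) p := hfd.comp p hs
  have hm : MDifferentiableAt (𝓡 m) (𝓡 n) (mapIn e e' f) p := he'd.comp p hc
  have h1 : mfderiv (𝓡 m) (𝓡 n) (f ∘ e.symm) p
      = (mfderiv (𝓡 m) (𝓡 n) f (e.symm p)).comp (mfderiv (𝓡 m) (𝓡 m) e.symm p) :=
    mfderiv_comp p hfd hs
  have h2 : mfderiv (𝓡 m) (𝓡 n) (e'.symm ∘ mapIn e e' f) p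
      = (mfderiv (𝓡 n) (𝓡 n) e'.symm (mapIn e e' f p)).comp
        (mfderiv (𝓡 m) (𝓡 n) (mapIn e e' f) p) := mfderiv_comp p hs' hm
  have h3 : (f ∘ e.symm) =ᶠ[nhds p] (e'.symm ∘ mapIn e e' f) := by
    filter_upwards [hc.continuousAt.preimage_mem_nhds (e'.open_source.mem_nhds hfp)] with q hq
    exact (e'.left_inv hq).symm
  have h4 : mfderiv (𝓡 m) (𝓡 n) (mapIn e e' f) p = fderiv ℝ (mapIn e e' f) p := mfderiv_eq_fderiv
  have h5 := h1.symm.trans (h3.mfderiv_eq.trans h2)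
  rw [h4] at h5
  exact congrArg (fun L : Eu m →L[ℝ] Eu n => L u) h5

theorem contDiffAt_mapIn {e' : OpenPartialHomeomorph N (Eu n)} (he : IsChart e)
    (he' : IsChart e') {f : M → N} (hp : p ∈ e.target) (hf : ContMDiffAt (𝓡 m) (𝓡 n) ∞ f (e.symm p))
    (hfp : f (e.symm p) ∈ e'.source) : ContDiffAt ℝ ∞ (mapIn e e' f) p :=
  ((he'.contMDiffAt hfp).comp p (hf.comp p (he.contMDiffAt_symm hp))).contDiffAt

/-- The change of coordinates from `e` to `e'`. -/
def transition (e e' : OpenPartialHomeomorph M (Eu m)) (p : Eu m) : Eu m := e' (e.symm p)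

variable {e' : OpenPartialHomeomorph M (Eu m)}

theorem contDiffAt_transition (he : IsChart e) (he' : IsChart e') (hp : p ∈ e.target)
    (hp' : e.symm p ∈ e'.source) : ContDiffAt ℝ ∞ (transition e e') p :=
  contDiffAt_mapIn (f := id) he he' hp contMDiffAt_id hp'

theorem chartFrame_transition (he : IsChart e) (he' : IsChart e') (hp : p ∈ e.target)
    (hp' : e.symm p ∈ e'.source) (u : Eu m) :
    chartFrame e p u
      = chartFrame e' (transition e e' p) (fderiv ℝ (transition e e') p u) := by
  have := mapDeriv_chartFrame (f := id) he he' hp contMDiffAt_id hp' u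
  rw [mapDeriv, mfderiv_id] at this
  exact this

theorem symm_transition (hp' : e.symm p ∈ e'.source) :
    e'.symm (transition e e' p) = e.symm p := e'.left_inv hp'

theorem transition_mem_target (hp' : e.symm p ∈ e'.source) : transition e e' p ∈ e'.target :=
  e'.map_source hp'

theorem transition_transition (hp : p ∈ e.target) (hp' : e.symm p ∈ e'.source) :
    transition e' e (transition e e' p) = p := by
  simp only [transition, e'.left_inv hp', e.right_inv hp]

theorem eventually_transition (hp : p ∈ e.target) (hp' : e.symm p ∈ e'.source) :
    ∀ᶠ q in nhds p, q ∈ e.target ∧ e.symm q ∈ e'.source :=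
  (e.open_target.eventually_mem hp).and
    ((e.continuousAt_symm hp).eventually_mem (e'.open_source.mem_nhds hp'))

theorem fderiv_transition_comp (he : IsChart e) (he' : IsChart e') (hp : p ∈ e.target)
    (hp' : e.symm p ∈ e'.source) (v : Eu m) :
    fderiv ℝ (transition e' e) (transition e e' p) (fderiv ℝ (transition e e') p v) = v := by
  have h0 : (∞ : WithTop ℕ∞) ≠ 0 := by simp
  have h1 := (contDiffAt_transition he he' hp hp').differentiableAt h0
  have h2 := (contDiffAt_transition he' he (transition_mem_target hp')
    (by rw [symm_transition hp']; exact e.map_target hp)).differentiableAt h0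
  have h3 : transition e' e ∘ transition e e' =ᶠ[nhds p] id := by
    filter_upwards [eventually_transition hp hp'] with q hq
    exact transition_transition hq.1 hq.2
  have h4 := (fderiv_comp p h2 h1).symm.trans h3.fderiv_eq
  rw [fderiv_id] at h4
  exact congrArg (fun L : Eu m →L[ℝ] Eu m => L v) h4

theorem fderiv_transition_comp' (he : IsChart e) (he' : IsChart e') (hp : p ∈ e.target)
    (hp' : e.symm p ∈ e'.source) (v : Eu m) :
    fderiv ℝ (transition e e') p (fderiv ℝ (transition e' e) (transition e e' p) v) = v := by
  have := fderiv_transition_comp he' he (transition_mem_target hp')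
    (by rw [symm_transition hp']; exact e.map_target hp) v
  rwa [transition_transition hp hp'] at this

theorem metricForm_transition (g : RMetric m M) (he : IsChart e) (he' : IsChart e')
    (hp : p ∈ e.target) (hp' : e.symm p ∈ e'.source) (u v : Eu m) :
    metricForm g e p u v = metricForm g e' (transition e e' p)
      (fderiv ℝ (transition e e') p u) (fderiv ℝ (transition e e') p v) := by
  rw [metricForm_apply, metricForm_apply, chartFrame_transition he he' hp hp',
    chartFrame_transition he he' hp hp', symm_transition hp']

/-- The inverse is the derivative of `e` itself. It serves to transfer positivity of the metric to
charts and to compare traces in different bases. -/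
theorem exists_chartFrame_inverse (he : IsChart e) (hp : p ∈ e.target) :
    ∃ D : Eu m →L[ℝ] Eu m, (∀ v, chartFrame e p (D v) = v) ∧ ∀ v, D (chartFrame e p v) = v := by
  have h0 : (∞ : WithTop ℕ∞) ≠ 0 := by simp
  have hs := (he.contMDiffAt_symm hp).mdifferentiableAt h0
  have hd := (he.contMDiffAt (e.map_target hp)).mdifferentiableAt h0
  refine ⟨mfderiv (𝓡 m) (𝓡 m) e (e.symm p), fun v => ?_, fun v => ?_⟩
  · have hs' : MDifferentiableAt (𝓡 m) (𝓡 m) e.symm (e (e.symm p)) := by rwa [e.right_inv hp]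
    have h1 : mfderiv (𝓡 m) (𝓡 m) (e.symm ∘ e) (e.symm p) = _ :=
      mfderiv_comp (e.symm p) hs' hd
    have h2 : e.symm ∘ e =ᶠ[nhds (e.symm p)] id := by
      filter_upwards [e.open_source.mem_nhds (e.map_target hp)] with q hq using e.left_inv hq
    rw [h2.mfderiv_eq, mfderiv_id, e.right_inv hp] at h1
    exact (congrArg (fun L : Eu m →L[ℝ] Eu m => L v) h1).symm
  · have h1 : mfderiv (𝓡 m) (𝓡 m) (e ∘ e.symm) p = _ := mfderiv_comp p hd hs
    have h2 : e ∘ e.symm =ᶠ[nhds p] id := by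
      filter_upwards [e.open_target.mem_nhds hp] with q hq using e.right_inv hq
    rw [h2.mfderiv_eq, mfderiv_id] at h1
    exact (congrArg (fun L : Eu m →L[ℝ] Eu m => L v) h1).symm

theorem metricForm_pos (g : RMetric m M) (he : IsChart e) (hp : p ∈ e.target) {u : Eu m}
    (hu : u ≠ 0) : 0 < metricForm g e p u u := by
  obtain ⟨D, -, hD⟩ := exists_chartFrame_inverse he hp
  refine innerForm_pos g _ fun h => hu ?_
  rw [← hD u]
  exact (congrArg D h).trans (map_zero D)

/-- A definite form is nondegenerate, so vector identities can be tested by pairing, where the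
Koszul formula applies. -/
theorem metricForm_ext (g : RMetric m M) (he : IsChart e) (hp : p ∈ e.target) {u v : Eu m}
    (h : ∀ w, metricForm g e p u w = metricForm g e p v w) : u = v := by
  by_contra hne
  have := metricForm_pos g he hp (sub_ne_zero.2 hne)
  rw [map_sub (metricForm g e p), _root_.sub_apply, h, sub_self] at this
  exact lt_irrefl _ this

theorem metricMatrix_posDef (g : RMetric m M) (he : IsChart e) (hp : p ∈ e.target) :
    (metricMatrix g e p).PosDef := by
  refine Matrix.PosDef.of_dotProduct_mulVec_pos ?_ fun x hx => ?_
  · refine Matrix.IsHermitian.ext fun i j => ?_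
    rw [star_trivial]
    exact metricForm_symm g e p _ _
  · have h := metricForm_pos g he hp (u := WithLp.toLp 2 x) (by simpa using hx)
    rw [bilin_eq_sum] at h
    refine h.trans_eq (Eq.symm ?_)
    simp only [dotProduct, Matrix.mulVec, Finset.mul_sum, smul_eq_mul]
    refine Finset.sum_congr rfl fun i _ => Finset.sum_congr rfl fun j _ => ?_
    rw [metricMatrix_apply, Pi.star_apply, star_trivial]
    ring

theorem metricMatrix_det_pos (g : RMetric m M) (he : IsChart e) (hp : p ∈ e.target) :
    0 < (metricMatrix g e p).det := (metricMatrix_posDef g he hp).det_pos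

theorem contDiffAt_metricMatrix (g : RMetric m M) (he : IsChart e) (hp : p ∈ e.target)
    (i j : Fin m) : ContDiffAt ℝ ∞ (fun q => metricMatrix g e q i j) p :=
  he.contDiffAt_metricForm_apply g hp _ _

theorem contDiffAt_metricMatrix_det (g : RMetric m M) (he : IsChart e) (hp : p ∈ e.target) :
    ContDiffAt ℝ ∞ (fun q => (metricMatrix g e q).det) p :=
  contDiffAt_det (contDiffAt_metricMatrix g he hp)

theorem contDiffAt_metricMatrix_inv (g : RMetric m M) (he : IsChart e) (hp : p ∈ e.target)
    (i j : Fin m) : ContDiffAt ℝ ∞ (fun q => (metricMatrix g e q)⁻¹ i j) p :=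
  contDiffAt_inv (contDiffAt_metricMatrix g he hp) (metricMatrix_det_pos g he hp).ne' i j

theorem metricMatrix_inv_symm (g : RMetric m M) (e : OpenPartialHomeomorph M (Eu m)) (p : Eu m)
    (i j : Fin m) : (metricMatrix g e p)⁻¹ i j = (metricMatrix g e p)⁻¹ j i := by
  have h : (metricMatrix g e p)ᵀ = metricMatrix g e p := by
    ext i j
    exact metricForm_symm g e p _ _
  have h2 := congrFun (congrFun (Matrix.transpose_nonsing_inv (metricMatrix g e p)) j) i
  rw [h] at h2
  exact h2

theorem metricMatrix_eq_transition (g : RMetric m M) (he : IsChart e) (he' : IsChart e')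
    (hp : p ∈ e.target) (hp' : e.symm p ∈ e'.source) :
    metricMatrix g e p
      = formMatrix (metricForm g e' (transition e e' p)) (fderiv ℝ (transition e e') p) := by
  ext i j
  exact metricForm_transition g he he' hp hp' _ _

theorem metricMatrix_det_transition (g : RMetric m M) (he : IsChart e) (he' : IsChart e')
    (hp : p ∈ e.target) (hp' : e.symm p ∈ e'.source) :
    (metricMatrix g e p).det = (fderiv ℝ (transition e e') p).det ^ 2
      * (metricMatrix g e' (transition e e' p)).det := by
  rw [metricMatrix_eq_transition g he he' hp hp', det_formMatrix]
  rfl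

end Charts

/-! ### Koszul formula and transformation laws of the connections. -/

section Christoffel

variable {m : ℕ} {M : Type*} [TopologicalSpace M] [ChartedSpace (Eu m) M]
  [IsManifold (𝓡 m) ∞ M] {e : OpenPartialHomeomorph M (Eu m)} {p : Eu m}

theorem partialD_eq (α : Fin m) (u : Eu m → ℝ) (p : Eu m) :
    partialD α u p = fderiv ℝ u p (stdVec α) := rfl

/-- The derivative of the metric in the chart `e`. -/
def metricDeriv (g : RMetric m M) (e : OpenPartialHomeomorph M (Eu m)) (p : Eu m) :
    Eu m →L[ℝ] Eu m →L[ℝ] Eu m →L[ℝ] ℝ :=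
  fderiv ℝ (metricForm g e) p

theorem hasFDerivAt_metricForm (g : RMetric m M) (he : IsChart e) (hp : p ∈ e.target) :
    HasFDerivAt (metricForm g e) (metricDeriv g e p) p :=
  ((he.contDiffAt_metricForm g hp).differentiableAt (by simp)).hasFDerivAt

theorem fderiv_metricForm_apply (g : RMetric m M) (he : IsChart e) (hp : p ∈ e.target)
    (u v w : Eu m) :
    fderiv ℝ (fun q => metricForm g e q u v) p w = metricDeriv g e p w u v := by
  have h := ((hasFDerivAt_metricForm g he hp).clm_apply (hasFDerivAt_const u p)).clm_apply
    (hasFDerivAt_const v p)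
  rw [h.fderiv]
  simp

theorem metricDeriv_symm (g : RMetric m M) (he : IsChart e) (hp : p ∈ e.target) (u v w : Eu m) :
    metricDeriv g e p w u v = metricDeriv g e p w v u := by
  rw [← fderiv_metricForm_apply g he hp, ← fderiv_metricForm_apply g he hp]
  simp only [metricForm_symm g e _ u v]

theorem partialD_metricMatrix (g : RMetric m M) (he : IsChart e) (hp : p ∈ e.target)
    (α σ β : Fin m) : partialD α (fun q => metricMatrix g e q σ β) p
      = metricDeriv g e p (stdVec α) (stdVec σ) (stdVec β) :=
  fderiv_metricForm_apply g he hp _ _ _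

/-- The Christoffel symbols as a bilinear map: `∑ G^γ_{αβ} u^α v^β`. -/
def christoffelVec (g : RMetric m M) (e : OpenPartialHomeomorph M (Eu m)) (p u v : Eu m) : Eu m :=
  ∑ α, ∑ β, (u α * v β) • ∑ γ, christoffel g e γ α β p • (stdVec γ : Eu m)

theorem sum_smul_stdVec_apply (c : Fin m → ℝ) (k : Fin m) :
    (∑ γ, c γ • (stdVec γ : Eu m)) k = c k := by
  simp [stdVec_apply]

theorem christoffelVec_apply (g : RMetric m M) (e : OpenPartialHomeomorph M (Eu m))
    (p u v : Eu m) (k : Fin m) :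
    christoffelVec g e p u v k = ∑ α, ∑ β, christoffel g e k α β p * u α * v β := by
  simp only [christoffelVec, WithLp.ofLp_sum, WithLp.ofLp_smul, Finset.sum_apply, Pi.smul_apply,
    smul_eq_mul]
  refine Finset.sum_congr rfl fun α _ => Finset.sum_congr rfl fun β _ => ?_
  have := sum_smul_stdVec_apply (fun γ => christoffel g e γ α β p) k
  simp only [WithLp.ofLp_sum, WithLp.ofLp_smul, Finset.sum_apply, Pi.smul_apply,
    smul_eq_mul] at this
  rw [this]
  ring

theorem metricForm_christoffel_stdVec (g : RMetric m M) (he : IsChart e) (hp : p ∈ e.target)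
    (α β : Fin m) (w : Eu m) :
    metricForm g e p (∑ γ, christoffel g e γ α β p • (stdVec γ : Eu m)) w
      = (1 / 2) * (metricDeriv g e p (stdVec α) (stdVec β) w
        + metricDeriv g e p (stdVec β) (stdVec α) w
        - metricDeriv g e p w (stdVec α) (stdVec β)) := by
  have hu : IsUnit (metricMatrix g e p).det := (metricMatrix_det_pos g he hp).ne'.isUnit
  suffices h : ∀ δ, metricForm g e p (∑ γ, christoffel g e γ α β p • (stdVec γ : Eu m)) (stdVec δ)
      = (1 / 2) * (metricDeriv g e p (stdVec α) (stdVec β) (stdVec δ)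
        + metricDeriv g e p (stdVec β) (stdVec α) (stdVec δ)
        - metricDeriv g e p (stdVec δ) (stdVec α) (stdVec β)) by
    rw [clm_eq_sum (metricForm g e p _) w, clm_eq_sum (metricDeriv g e p (stdVec α) _) w,
      clm_eq_sum (metricDeriv g e p (stdVec β) _) w, clm_eq_sum (metricDeriv g e p) w]
    simp only [h, _root_.sum_apply, _root_.smul_apply, smul_eq_mul, ← Finset.sum_add_distrib,
      ← Finset.sum_sub_distrib, Finset.mul_sum]
    exact Finset.sum_congr rfl fun i _ => by ring
  intro δ
  -- Pairing with a basis vector lowers the upper index, and the metric cancels the inverse matrix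
  -- in the definition of the symbols.
  have h1 : ∀ σ, ∑ γ, (metricMatrix g e p)⁻¹ γ σ * metricForm g e p (stdVec γ) (stdVec δ)
      = if σ = δ then 1 else 0 := by
    intro σ
    have := congrFun (congrFun (Matrix.nonsing_inv_mul _ hu) σ) δ
    rw [Matrix.mul_apply, Matrix.one_apply] at this
    rw [← this]
    exact Finset.sum_congr rfl fun γ _ => by
      rw [metricMatrix_inv_symm g e p γ σ, metricMatrix_apply]
  simp only [map_sum, map_smul, _root_.sum_apply, _root_.smul_apply, smul_eq_mul, christoffel,
    partialD_metricMatrix g he hp]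
  calc _ = (1 / 2) * ∑ σ, (∑ γ, (metricMatrix g e p)⁻¹ γ σ
          * metricForm g e p (stdVec γ) (stdVec δ))
        * (metricDeriv g e p (stdVec α) (stdVec σ) (stdVec β)
        + metricDeriv g e p (stdVec β) (stdVec σ) (stdVec α)
        - metricDeriv g e p (stdVec σ) (stdVec α) (stdVec β)) := by
        simp only [Finset.mul_sum, Finset.sum_mul]
        rw [Finset.sum_comm]
        exact Finset.sum_congr rfl fun σ _ => Finset.sum_congr rfl fun γ _ => by ring
    _ = _ := by
        simp only [h1, ite_mul, one_mul, zero_mul, Finset.sum_ite_eq', Finset.mem_univ, if_true]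
        rw [metricDeriv_symm g he hp (stdVec δ) (stdVec β),
          metricDeriv_symm g he hp (stdVec δ) (stdVec α)]

/-- The Koszul formula. -/
theorem metricForm_christoffelVec (g : RMetric m M) (he : IsChart e) (hp : p ∈ e.target)
    (u v w : Eu m) :
    metricForm g e p (christoffelVec g e p u v) w
      = (1 / 2) * (metricDeriv g e p u v w + metricDeriv g e p v u w
        - metricDeriv g e p w u v) := by
  rw [bilin_eq_sum (metricDeriv g e p) u v, bilin_eq_sum (metricDeriv g e p) v u,
    bilin_eq_sum (metricDeriv g e p w) u v, Finset.sum_comm (f := fun i j => (v i * u j) • _)]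
  simp only [christoffelVec, map_sum, map_smul, _root_.sum_apply, _root_.smul_apply, smul_eq_mul,
    ← Finset.sum_add_distrib, ← Finset.sum_sub_distrib]
  rw [Finset.mul_sum]
  simp only [Finset.mul_sum (a := (1 / 2 : ℝ))]
  refine Finset.sum_congr rfl fun α _ => Finset.sum_congr rfl fun β _ => ?_
  have := metricForm_christoffel_stdVec g he hp α β w
  simp only [map_sum, map_smul, _root_.sum_apply, _root_.smul_apply, smul_eq_mul] at this
  rw [this]
  ring

theorem hasFDerivAt_fderiv_transition {e' : OpenPartialHomeomorph M (Eu m)} (he : IsChart e)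
    (he' : IsChart e') (hp : p ∈ e.target) (hp' : e.symm p ∈ e'.source) :
    HasFDerivAt (fderiv ℝ (transition e e')) (fderiv ℝ (fderiv ℝ (transition e e')) p) p :=
  (((contDiffAt_transition he he' hp hp').fderiv_right (m := 1) (by norm_cast)).differentiableAt
    one_ne_zero).hasFDerivAt

theorem hasFDerivAt_transition {e' : OpenPartialHomeomorph M (Eu m)} (he : IsChart e)
    (he' : IsChart e') (hp : p ∈ e.target) (hp' : e.symm p ∈ e'.source) :
    HasFDerivAt (transition e e') (fderiv ℝ (transition e e') p) p :=
  ((contDiffAt_transition he he' hp hp').differentiableAt (by simp)).hasFDerivAt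

/-- Differentiate the transformation rule of the metric. The two second-derivative terms are the
source of the inhomogeneous term in the law for the Christoffel symbols. -/
theorem metricDeriv_transition {e' : OpenPartialHomeomorph M (Eu m)} (g : RMetric m M)
    (he : IsChart e) (he' : IsChart e') (hp : p ∈ e.target) (hp' : e.symm p ∈ e'.source)
    (a b c : Eu m) :
    metricDeriv g e p a b c
      = metricDeriv g e' (transition e e' p) (fderiv ℝ (transition e e') p a)
          (fderiv ℝ (transition e e') p b) (fderiv ℝ (transition e e') p c)
        + metricForm g e' (transition e e' p) (fderiv ℝ (fderiv ℝ (transition e e')) p a b)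
          (fderiv ℝ (transition e e') p c)
        + metricForm g e' (transition e e' p) (fderiv ℝ (transition e e') p b)
          (fderiv ℝ (fderiv ℝ (transition e e')) p a c) := by
  have h1 := hasFDerivAt_transition he he' hp hp'
  have h2 := hasFDerivAt_fderiv_transition he he' hp hp'
  have h3 := (hasFDerivAt_metricForm g he' (transition_mem_target hp')).comp p h1
  have h4 := (h3.clm_apply (h2.clm_apply (hasFDerivAt_const b p))).clm_apply
    (h2.clm_apply (hasFDerivAt_const c p))
  have h5 : (fun q => metricForm g e q b c) =ᶠ[nhds p] fun q =>
      metricForm g e' (transition e e' q) (fderiv ℝ (transition e e') q b)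
        (fderiv ℝ (transition e e') q c) := by
    filter_upwards [eventually_transition hp hp'] with q hq
    exact metricForm_transition g he he' hq.1 hq.2 b c
  rw [← fderiv_metricForm_apply g he hp, h5.fderiv_eq]
  refine (congrArg (fun L : Eu m →L[ℝ] ℝ => L a) h4.fderiv).trans ?_
  simp
  ring

theorem fderiv_fderiv_symm {E F : Type*} [NormedAddCommGroup E] [NormedSpace ℝ E]
    [NormedAddCommGroup F] [NormedSpace ℝ F] {f : E → F} {x : E} (hf : ContDiffAt ℝ ∞ f x)
    (u v : E) : fderiv ℝ (fderiv ℝ f) x u v = fderiv ℝ (fderiv ℝ f) x v u :=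
  (hf.isSymmSndFDerivAt (by simpa using (by norm_cast : (2 : WithTop ℕ∞) ≤ ∞))).eq u v

/-- The transformation law of the Christoffel symbols. -/
theorem christoffelVec_transition {e' : OpenPartialHomeomorph M (Eu m)} (g : RMetric m M)
    (he : IsChart e) (he' : IsChart e') (hp : p ∈ e.target) (hp' : e.symm p ∈ e'.source)
    (u v : Eu m) :
    fderiv ℝ (transition e e') p (christoffelVec g e p u v)
      = fderiv ℝ (fderiv ℝ (transition e e')) p u v
        + christoffelVec g e' (transition e e' p) (fderiv ℝ (transition e e') p u)
          (fderiv ℝ (transition e e') p v) := by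
  have hs := fderiv_fderiv_symm (contDiffAt_transition he he' hp hp')
  have ht := transition_mem_target hp'
  refine metricForm_ext g he' ht fun w' => ?_
  -- Writing the test vector as an image allows the pairing to be pulled back to `e`. After the
  -- Koszul formula on both sides, four of the six second-derivative terms cancel by symmetry and
  -- the other two agree.
  rw [← fderiv_transition_comp' he he' hp hp' w']
  set w := fderiv ℝ (transition e' e) (transition e e' p) w'
  rw [← metricForm_transition g he he' hp hp', metricForm_christoffelVec g he hp, map_add,
    _root_.add_apply, metricForm_christoffelVec g he' ht, metricDeriv_transition g he he' hp hp',
    metricDeriv_transition g he he' hp hp', metricDeriv_transition g he he' hp hp',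
    hs v u, hs w u, hs w v,
    metricForm_symm g e' _ (fderiv ℝ (transition e e') p u)
      (fderiv ℝ (fderiv ℝ (transition e e')) p v w),
    metricForm_symm g e' _ (fderiv ℝ (transition e e') p v)
      (fderiv ℝ (fderiv ℝ (transition e e')) p u w)]
  ring

/-- The function `ln (det g / det φ)` in the chart `e`. -/
def logRatio (g φ : RMetric m M) (e : OpenPartialHomeomorph M (Eu m)) (q : Eu m) : ℝ :=
  Real.log ((metricMatrix g e q).det / (metricMatrix φ e q).det)

theorem contDiffAt_logRatio (g φ : RMetric m M) (he : IsChart e) (hp : p ∈ e.target) :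
    ContDiffAt ℝ ∞ (logRatio g φ e) p :=
  ((contDiffAt_metricMatrix_det g he hp).div (contDiffAt_metricMatrix_det φ he hp)
    (metricMatrix_det_pos φ he hp).ne').log
    (div_pos (metricMatrix_det_pos g he hp) (metricMatrix_det_pos φ he hp)).ne'

/-- Both determinants are multiplied by the same squared Jacobian, so the ratio is a function on `M`
and its differential is a covector. -/
theorem logRatio_transition {e' : OpenPartialHomeomorph M (Eu m)} (g φ : RMetric m M)
    (he : IsChart e) (he' : IsChart e') (hp : p ∈ e.target) (hp' : e.symm p ∈ e'.source) :
    logRatio g φ e p = logRatio g φ e' (transition e e' p) := by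
  have h := metricMatrix_det_pos g he hp
  simp only [logRatio]
  rw [metricMatrix_det_transition g he he' hp hp'] at h ⊢
  rw [metricMatrix_det_transition φ he he' hp hp', mul_div_mul_left]
  exact left_ne_zero_of_mul h.ne'

theorem fderiv_logRatio_transition {e' : OpenPartialHomeomorph M (Eu m)} (g φ : RMetric m M)
    (he : IsChart e) (he' : IsChart e') (hp : p ∈ e.target) (hp' : e.symm p ∈ e'.source)
    (u : Eu m) :
    fderiv ℝ (logRatio g φ e) p u
      = fderiv ℝ (logRatio g φ e') (transition e e' p) (fderiv ℝ (transition e e') p u) := by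
  have h1 : logRatio g φ e =ᶠ[nhds p] logRatio g φ e' ∘ transition e e' := by
    filter_upwards [eventually_transition hp hp'] with q hq
    exact logRatio_transition g φ he he' hq.1 hq.2
  rw [h1.fderiv_eq, fderiv_comp p ((contDiffAt_logRatio g φ he'
    (transition_mem_target hp')).differentiableAt (by simp))
    (hasFDerivAt_transition he he' hp hp').differentiableAt]
  rfl

/-- The symbols `Δ^γ_{αβ}` as a bilinear map. -/
def deltaVec (g φ : RMetric m M) (e : OpenPartialHomeomorph M (Eu m)) (p u v : Eu m) : Eu m :=
  christoffelVec g e p u v + ((1 / 2) * fderiv ℝ (logRatio g φ e) p u) • v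

theorem deltaVec_apply (g φ : RMetric m M) (e : OpenPartialHomeomorph M (Eu m))
    (p u v : Eu m) (k : Fin m) :
    deltaVec g φ e p u v k = ∑ α, ∑ β, deltaSymbol g φ e k α β p * u α * v β := by
  simp only [deltaVec, PiLp.add_apply, PiLp.smul_apply, smul_eq_mul, christoffelVec_apply,
    deltaSymbol, add_mul, Finset.sum_add_distrib]
  congr 1
  rw [clm_eq_sum, Finset.mul_sum, Finset.sum_mul]
  refine Finset.sum_congr rfl fun α _ => ?_
  rw [Finset.sum_eq_single k (fun b _ hb => by simp [hb.symm]) (by simp)]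
  rw [if_pos rfl, smul_eq_mul, partialD_eq]
  change _ * (_ * fderiv ℝ (logRatio g φ e) p _) * _ = _ * fderiv ℝ (logRatio g φ e) p _ * _ * _ * _
  ring

/-- The logarithmic correction is tensorial, so `Δ` obeys the same law as the Christoffel symbols;
hence a geodesic found in one chart satisfies the equation in all charts. -/
theorem deltaVec_transition {e' : OpenPartialHomeomorph M (Eu m)} (g φ : RMetric m M)
    (he : IsChart e) (he' : IsChart e') (hp : p ∈ e.target) (hp' : e.symm p ∈ e'.source)
    (u v : Eu m) :
    fderiv ℝ (transition e e') p (deltaVec g φ e p u v)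
      = fderiv ℝ (fderiv ℝ (transition e e')) p u v
        + deltaVec g φ e' (transition e e' p) (fderiv ℝ (transition e e') p u)
          (fderiv ℝ (transition e e') p v) := by
  rw [deltaVec, deltaVec, map_add, christoffelVec_transition g he he' hp hp', map_smul,
    fderiv_logRatio_transition g φ he he' hp hp', add_assoc]

end Christoffel

/-! ### Existence of geodesics and the equation on their images. -/

section Geodesics

variable {m n : ℕ} {M : Type*} [TopologicalSpace M] [ChartedSpace (Eu m) M]
  [IsManifold (𝓡 m) ∞ M] {N : Type*} [TopologicalSpace N] [ChartedSpace (Eu n) N]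
  [IsManifold (𝓡 n) ∞ N] {e : OpenPartialHomeomorph M (Eu m)} {p : Eu m}

theorem contDiffAt_partialD {u : Eu m → ℝ} (hu : ContDiffAt ℝ ∞ u p) (α : Fin m) :
    ContDiffAt ℝ ∞ (partialD α u) p :=
  (hu.fderiv_right (m := ∞) (by simp)).clm_apply contDiffAt_const

theorem contDiffAt_christoffel (g : RMetric m M) (he : IsChart e) (hp : p ∈ e.target)
    (γ α β : Fin m) : ContDiffAt ℝ ∞ (christoffel g e γ α β) p := by
  refine contDiffAt_const.mul (ContDiffAt.sum fun σ _ => ?_)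
  refine (contDiffAt_metricMatrix_inv g he hp γ σ).mul ?_
  have h := fun α β => contDiffAt_metricMatrix g he hp α β
  exact ((contDiffAt_partialD (h σ β) α).add (contDiffAt_partialD (h σ α) β)).sub
    (contDiffAt_partialD (h α β) σ)

theorem contDiffAt_deltaVec (g φ : RMetric m M) (he : IsChart e) (hp : p ∈ e.target) (b : Eu m) :
    ContDiffAt ℝ ∞ (fun z : Eu m × Eu m => deltaVec g φ e z.1 z.2 z.2) (p, b) := by
  have h1 : ContDiffAt ℝ ∞ (Prod.fst : Eu m × Eu m → Eu m) (p, b) := contDiffAt_fst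
  have h2 : ContDiffAt ℝ ∞ (Prod.snd : Eu m × Eu m → Eu m) (p, b) := contDiffAt_snd
  have hc : ∀ i, ContDiffAt ℝ ∞ (fun z : Eu m × Eu m => z.2 i) (p, b) := fun i => by fun_prop
  refine ContDiffAt.add ?_ ?_
  · refine ContDiffAt.sum fun α _ => ContDiffAt.sum fun β _ => ((hc α).mul (hc β)).smul ?_
    refine ContDiffAt.sum fun γ _ => ?_
    have h3 := (contDiffAt_christoffel g he hp γ α β).comp (p, b) h1
    exact h3.smul contDiffAt_const
  · have := (contDiffAt_logRatio g φ he hp).fderiv_right (m := ∞) (by simp)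
    have h3 := (this.comp (p, b) h1).clm_apply h2
    exact (contDiffAt_const.mul h3).smul h2

theorem hasDerivAt_apply {x : ℝ → Eu m} {v : Eu m} {t : ℝ} (hx : HasDerivAt x v t) (k : Fin m) :
    HasDerivAt (fun s => x s k) (v k) t :=
  (PiLp.proj 2 (fun _ : Fin m => ℝ) k : Eu m →L[ℝ] ℝ).hasFDerivAt.comp_hasDerivAt t hx

theorem deriv_comp_coord {Φ : Eu m → Eu n} {x v : ℝ → Eu m} {t : ℝ}
    (hΦ : ContDiffAt ℝ ∞ Φ (x t)) (hx : HasDerivAt x (v t) t) (k : Fin n) :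
    deriv (fun s => Φ (x s) k) t = fderiv ℝ Φ (x t) (v t) k :=
  (hasDerivAt_apply ((hΦ.differentiableAt (by simp)).hasFDerivAt.comp_hasDerivAt t hx) k).deriv

/-- The second-order chain rule is needed twice: for `Φ` a change of chart, and for `Φ` the
coordinate expression of `f`. -/
theorem deriv_deriv_comp_coord {Φ : Eu m → Eu n} {x v : ℝ → Eu m} {a : Eu m} {t : ℝ}
    (hΦ : ContDiffAt ℝ ∞ Φ (x t)) (hx : ∀ᶠ s in nhds t, HasDerivAt x (v s) s)
    (hv : HasDerivAt v a t) (k : Fin n) :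
    deriv (deriv (fun s => Φ (x s) k)) t
      = (fderiv ℝ (fderiv ℝ Φ) (x t) (v t) (v t) + fderiv ℝ Φ (x t) a) k := by
  have hxt := hx.self_of_nhds
  have h1 : deriv (fun s => Φ (x s) k) =ᶠ[nhds t] fun s => fderiv ℝ Φ (x s) (v s) k := by
    have : ∀ᶠ y in nhds (x t), ContDiffAt ℝ 1 Φ y :=
      (hΦ.of_le (m := 1) (by norm_cast)).eventually (by simp)
    filter_upwards [hx, hxt.continuousAt.eventually this] with s hs hs'
    exact (hasDerivAt_apply ((hs'.differentiableAt one_ne_zero).hasFDerivAt.comp_hasDerivAt s hs)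
      k).deriv
  have h2 := (((hΦ.fderiv_right (m := 1) (by norm_cast)).differentiableAt
    one_ne_zero).hasFDerivAt.comp_hasDerivAt t hxt).clm_apply hv
  rw [h1.deriv_eq]
  exact (hasDerivAt_apply h2 k).deriv

/-- Through every point and in every direction there is a geodesic of the pair `(g, φ)`. -/
theorem exists_isPairGeodesic (g φ : RMetric m M) (he : IsChart e) (hp : p ∈ e.target)
    (b : Eu m) :
    ∃ ε > (0 : ℝ), ∃ x v : ℝ → Eu m, x 0 = p ∧ v 0 = b ∧
      (∀ t ∈ Ioo (-ε) ε, HasDerivAt x (v t) t) ∧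
      HasDerivAt v (-deltaVec g φ e p b b) 0 ∧
      IsPairGeodesic g φ (e.symm ∘ x) (Ioo (-ε) ε) := by
  -- The geodesic equation as a first-order system in position and velocity, to which local
  -- existence for `C¹` vector fields applies.
  have hX : ContDiffAt ℝ 1 (fun z : Eu m × Eu m => (z.2, -deltaVec g φ e z.1 z.2 z.2)) (p, b) :=
    (contDiffAt_snd.prodMk (contDiffAt_deltaVec g φ he hp b).neg).of_le (by norm_cast)
  obtain ⟨z, hz0, ε₁, hε₁, hz⟩ :=
    hX.exists_forall_mem_closedBall_exists_eq_forall_mem_Ioo_hasDerivAt₀ 0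
  simp only [zero_sub, zero_add] at hz
  have h0 : (0 : ℝ) ∈ Ioo (-ε₁) ε₁ := ⟨by linarith, hε₁⟩
  have hct : ∀ᶠ t in nhds (0 : ℝ), (z t).1 ∈ e.target := by
    have hc : ContinuousAt (fun t => (z t).1) 0 := (hz 0 h0).continuousAt.fst
    exact hc.eventually_mem (e.open_target.mem_nhds (by rw [hz0]; exact hp))
  obtain ⟨ε₂, hε₂, hε⟩ := Metric.eventually_nhds_iff_ball.1 hct
  -- The interval is shrunk so that the solution stays in the target of the chart.
  set ε := min ε₁ ε₂
  have hεp : 0 < ε := lt_min hε₁ hε₂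
  have ht : ∀ t ∈ Ioo (-ε) ε, (z t).1 ∈ e.target := fun t ht => hε t <| by
    rw [Real.ball_eq_Ioo]
    exact ⟨by linarith [ht.1, min_le_right ε₁ ε₂], by linarith [ht.2, min_le_right ε₁ ε₂]⟩
  have hzd : ∀ t ∈ Ioo (-ε) ε, HasDerivAt z
      ((z t).2, -deltaVec g φ e (z t).1 (z t).2 (z t).2) t := fun t ht => hz t
    ⟨by linarith [ht.1, min_le_left ε₁ ε₂], by linarith [ht.2, min_le_left ε₁ ε₂]⟩
  have hx : ∀ t ∈ Ioo (-ε) ε, HasDerivAt (fun s => (z s).1) (z t).2 t :=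
    fun t ht => (hzd t ht).fst
  have hv : ∀ t ∈ Ioo (-ε) ε, HasDerivAt (fun s => (z s).2)
      (-deltaVec g φ e (z t).1 (z t).2 (z t).2) t := fun t ht => (hzd t ht).snd
  refine ⟨ε, hεp, fun t => (z t).1, fun t => (z t).2, congrArg Prod.fst hz0,
    congrArg Prod.snd hz0, hx, ?_, ?_, ?_⟩
  · have := hv 0 ⟨by linarith, hεp⟩
    rwa [hz0] at this
  -- Regularity bootstraps: `z` is `C¹` because its derivative is a continuous expression in `z`,
  -- and the position is then `C²` because its derivative is the velocity component of `z`.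
  · have hzc : ContDiffOn ℝ 1 z (Ioo (-ε) ε) := by
      rw [show (1 : WithTop ℕ∞) = 0 + 1 from rfl, contDiffOn_succ_iff_deriv_of_isOpen isOpen_Ioo]
      refine ⟨fun t ht => (hzd t ht).differentiableAt.differentiableWithinAt, by simp, ?_⟩
      rw [contDiffOn_zero]
      intro t htt
      have hcd := (contDiffAt_deltaVec g φ he (ht t htt) (z t).2).continuousAt
      have hzt := (hzd t htt).continuousAt
      have hc : ContinuousAt (fun s => ((z s).2, -deltaVec g φ e (z s).1 (z s).2 (z s).2)) t :=
        hzt.snd.prodMk (ContinuousAt.comp (f := z) hcd hzt).neg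
      refine (hc.congr ?_).continuousWithinAt
      filter_upwards [isOpen_Ioo.mem_nhds htt] with s hs using (hzd s hs).deriv.symm
    have hxc : ContDiffOn ℝ 2 (fun t => (z t).1) (Ioo (-ε) ε) := by
      rw [show (2 : WithTop ℕ∞) = 1 + 1 from by norm_num,
        contDiffOn_succ_iff_deriv_of_isOpen isOpen_Ioo]
      refine ⟨fun t ht => (hx t ht).differentiableAt.differentiableWithinAt, by simp, ?_⟩
      exact hzc.snd.congr fun t ht => (hx t ht).deriv
    exact ((contMDiffOn_symm_of_mem_maximalAtlas he).of_le (by norm_cast)).comp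
      hxc.contMDiffOn ht
  · intro e' he' t htt hte k
    have hΦ := contDiffAt_transition he he' (ht t htt) hte
    have hxe : ∀ᶠ s in nhds t, HasDerivAt (fun s => (z s).1) (z s).2 s := by
      filter_upwards [isOpen_Ioo.mem_nhds htt] with s hs using hx s hs
    have h2 := deriv_deriv_comp_coord (x := fun s => (z s).1) (v := fun s => (z s).2) hΦ hxe
      (hv t htt) k
    have h1 := fun k => deriv_comp_coord (x := fun s => (z s).1) (v := fun s => (z s).2) hΦ
      (hx t htt) k
    have h3 : ∀ k, curveCoord e' (e.symm ∘ fun s => (z s).1) k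
        = fun s => transition e e' ((z s).1) k := fun k => rfl
    have h4 := deltaVec_transition g φ he he' (ht t htt) hte (z t).2 (z t).2
    simp only [h3]
    -- The Hessian of the coordinate change cancels against the inhomogeneous term in the law for
    -- `Δ`.
    rw [h2, map_neg, h4]
    simp only [h1]
    have h5 := deltaVec_apply g φ e' (transition e e' (z t).1)
      (fderiv ℝ (transition e e') (z t).1 (z t).2) (fderiv ℝ (transition e e') (z t).1 (z t).2) k
    refine Eq.trans ?_ (congrArg Neg.neg h5)
    simp

/-- A map carrying geodesics to geodesics satisfies the equation of the second fundamental form on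
the diagonal. -/
theorem second_fundamental_form_eq_zero {e' : OpenPartialHomeomorph N (Eu n)} (g φ : RMetric m M)
    (h : RMetric n N) {f : M → N} (hf : ContMDiff (𝓡 m) (𝓡 n) ∞ f)
    (hgeo : ∀ (J : Set ℝ) (c : ℝ → M), IsOpen J → J.OrdConnected →
      IsPairGeodesic g φ c J → IsGeodesic h (f ∘ c) J)
    (he : IsChart e) (he' : IsChart e') (hp : p ∈ e.target) (hfp : f (e.symm p) ∈ e'.source)
    (b : Eu m) :
    fderiv ℝ (fderiv ℝ (mapIn e e' f)) p b b - fderiv ℝ (mapIn e e' f) p (deltaVec g φ e p b b)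
      + christoffelVec h e' (mapIn e e' f p) (fderiv ℝ (mapIn e e' f) p b)
        (fderiv ℝ (mapIn e e' f) p b) = 0 := by
  obtain ⟨ε, hε, x, v, hx0, hv0, hx, hv, hc⟩ := exists_isPairGeodesic g φ he hp b
  have h0 : (0 : ℝ) ∈ Ioo (-ε) ε := ⟨by linarith, hε⟩
  have hΦ : ContDiffAt ℝ ∞ (mapIn e e' f) (x 0) := by
    rw [hx0]; exact contDiffAt_mapIn he he' hp hf.contMDiffAt hfp
  have hxe : ∀ᶠ s in nhds (0 : ℝ), HasDerivAt x (v s) s := by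
    filter_upwards [isOpen_Ioo.mem_nhds h0] with s hs using hx s hs
  have h1 := fun k => deriv_comp_coord hΦ (hx 0 h0) k
  have h2 := fun k => deriv_deriv_comp_coord hΦ hxe hv k
  ext k
  have h3 := (hgeo _ _ isOpen_Ioo ordConnected_Ioo hc).2 e' he' 0 h0
    (by simpa [hx0] using hfp) k
  have h4 : ∀ k, curveCoord e' (f ∘ e.symm ∘ x) k = fun s => mapIn e e' f (x s) k :=
    fun k => rfl
  -- At time zero the curve has position `p`, velocity `b` and acceleration `-Δ(b, b)`.
  simp only [h4, h1, h2, hx0, hv0, Function.comp_apply] at h3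
  have h5 := christoffelVec_apply h e' (mapIn e e' f p) (fderiv ℝ (mapIn e e' f) p b)
    (fderiv ℝ (mapIn e e' f) p b) k
  have h6 := h3.trans (congrArg Neg.neg h5.symm)
  simp only [map_neg, PiLp.add_apply, PiLp.neg_apply] at h6
  simp only [PiLp.add_apply, PiLp.sub_apply, PiLp.zero_apply]
  linarith

end Geodesics

/-! ### Vanishing of the tension field and the equations in coordinates. -/

section HarmonicEquations

variable {m n : ℕ} {M : Type*} [TopologicalSpace M] [ChartedSpace (Eu m) M]
  [IsManifold (𝓡 m) ∞ M] {N : Type*} [TopologicalSpace N] [ChartedSpace (Eu n) N]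
  [IsManifold (𝓡 n) ∞ N] {e : OpenPartialHomeomorph M (Eu m)}
  {e' : OpenPartialHomeomorph N (Eu n)} {p : Eu m}

theorem christoffelVec_add_left (g : RMetric m M) (e : OpenPartialHomeomorph M (Eu m))
    (p u v w : Eu m) :
    christoffelVec g e p (u + v) w = christoffelVec g e p u w + christoffelVec g e p v w := by
  simp [christoffelVec, add_mul, add_smul, Finset.sum_add_distrib]

theorem christoffelVec_add_right (g : RMetric m M) (e : OpenPartialHomeomorph M (Eu m))
    (p u v w : Eu m) :
    christoffelVec g e p u (v + w) = christoffelVec g e p u v + christoffelVec g e p u w := by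
  simp [christoffelVec, mul_add, add_smul, Finset.sum_add_distrib]

theorem deltaVec_add_left (g φ : RMetric m M) (e : OpenPartialHomeomorph M (Eu m))
    (p u v w : Eu m) :
    deltaVec g φ e p (u + v) w = deltaVec g φ e p u w + deltaVec g φ e p v w := by
  simp only [deltaVec, christoffelVec_add_left, map_add, mul_add, add_smul]
  abel

theorem deltaVec_add_right (g φ : RMetric m M) (e : OpenPartialHomeomorph M (Eu m))
    (p u v w : Eu m) :
    deltaVec g φ e p u (v + w) = deltaVec g φ e p u v + deltaVec g φ e p u w := by
  simp only [deltaVec, christoffelVec_add_right, smul_add]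
  abel

/-- The second fundamental form of the map `f`, in the charts `e` and `e'`. -/
def secondForm (g φ : RMetric m M) (h : RMetric n N) (e : OpenPartialHomeomorph M (Eu m))
    (e' : OpenPartialHomeomorph N (Eu n)) (f : M → N) (p u v : Eu m) : Eu n :=
  fderiv ℝ (fderiv ℝ (mapIn e e' f)) p u v - fderiv ℝ (mapIn e e' f) p (deltaVec g φ e p u v)
    + christoffelVec h e' (mapIn e e' f p) (fderiv ℝ (mapIn e e' f) p u)
        (fderiv ℝ (mapIn e e' f) p v)

/-- The tension field of the map `f`, in the charts `e` and `e'`. -/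
def tension (g φ : RMetric m M) (h : RMetric n N) (e : OpenPartialHomeomorph M (Eu m))
    (e' : OpenPartialHomeomorph N (Eu n)) (f : M → N) (p : Eu m) : Eu n :=
  ∑ α, ∑ β, (metricMatrix g e p)⁻¹ α β • secondForm g φ h e e' f p (stdVec α) (stdVec β)

/-- Exchanging the indices changes the sign of the sum. This suffices for the second fundamental
form, which is known to vanish only on the diagonal because `Δ` may have torsion. -/
theorem sum_eq_zero_of_antisymm {F : Type*} [AddCommGroup F] [Module ℝ F]
    {G : Fin m → Fin m → ℝ} (hG : ∀ i j, G i j = G j i) {c : Fin m → Fin m → F}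
    (hc : ∀ i j, c i j + c j i = 0) : ∑ i, ∑ j, G i j • c i j = 0 := by
  have h1 : ∑ i, ∑ j, G i j • c i j = ∑ i, ∑ j, G i j • c j i := by
    rw [Finset.sum_comm]
    exact Finset.sum_congr rfl fun i _ => Finset.sum_congr rfl fun j _ => by rw [hG]
  have h2 : (2 : ℝ) • ∑ i, ∑ j, G i j • c i j = 0 := by
    rw [two_smul]
    nth_rewrite 2 [h1]
    simp only [← Finset.sum_add_distrib, ← smul_add, hc, smul_zero, Finset.sum_const_zero]
  exact (smul_eq_zero.1 h2).resolve_left two_ne_zero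

theorem tension_eq_zero (g φ : RMetric m M)
    (h : RMetric n N) {f : M → N} (hf : ContMDiff (𝓡 m) (𝓡 n) ∞ f)
    (hgeo : ∀ (J : Set ℝ) (c : ℝ → M), IsOpen J → J.OrdConnected →
      IsPairGeodesic g φ c J → IsGeodesic h (f ∘ c) J)
    (he : IsChart e) (he' : IsChart e') (hp : p ∈ e.target) (hfp : f (e.symm p) ∈ e'.source) :
    tension g φ h e e' f p = 0 := by
  refine sum_eq_zero_of_antisymm (metricMatrix_inv_symm g e p) fun α β => ?_
  have hq := second_fundamental_form_eq_zero g φ h hf hgeo he he' hp hfp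
  -- Polarization of the quadratic identity.
  have h1 := hq (stdVec α + stdVec β)
  have h2 := hq (stdVec α)
  have h3 := hq (stdVec β)
  simp only [map_add, _root_.add_apply, deltaVec_add_left, deltaVec_add_right,
    christoffelVec_add_left, christoffelVec_add_right] at h1
  simp only [secondForm]
  linear_combination (norm := module) h1 - h2 - h3

theorem fderiv_apply_coord {E : Type*} [NormedAddCommGroup E] [NormedSpace ℝ E] {Φ : E → Eu n}
    {q : E} (hΦ : DifferentiableAt ℝ Φ q) (k : Fin n) (u : E) :
    fderiv ℝ (fun q => Φ q k) q u = fderiv ℝ Φ q u k := by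
  have := (PiLp.proj 2 (fun _ : Fin n => ℝ) k : Eu n →L[ℝ] ℝ).hasFDerivAt.comp q hΦ.hasFDerivAt
  exact congrArg (fun L : E →L[ℝ] ℝ => L u) this.fderiv

theorem partialD_mapCoord {f : M → N} (hf : ContDiffAt ℝ ∞ (mapIn e e' f) p) (k : Fin n)
    (α : Fin m) :
    partialD α (mapCoord e e' f k) p = fderiv ℝ (mapIn e e' f) p (stdVec α) k :=
  fderiv_apply_coord (hf.differentiableAt (by simp)) k _

theorem partialD_partialD_mapCoord {f : M → N} (hf : ContDiffAt ℝ ∞ (mapIn e e' f) p) (k : Fin n)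
    (α β : Fin m) :
    partialD α (partialD β (mapCoord e e' f k)) p
      = fderiv ℝ (fderiv ℝ (mapIn e e' f)) p (stdVec α) (stdVec β) k := by
  have h1 : partialD β (mapCoord e e' f k)
      =ᶠ[nhds p] fun q => fderiv ℝ (mapIn e e' f) q (stdVec β) k := by
    filter_upwards [(hf.of_le (m := 1) (by norm_cast)).eventually (by simp)] with q hq
    exact fderiv_apply_coord (hq.differentiableAt one_ne_zero) k _
  have h2 : HasFDerivAt (fderiv ℝ (mapIn e e' f)) (fderiv ℝ (fderiv ℝ (mapIn e e' f)) p) p :=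
    ((hf.fderiv_right (m := 1) (by norm_cast)).differentiableAt one_ne_zero).hasFDerivAt
  have h3 := h2.clm_apply (hasFDerivAt_const (stdVec β : Eu m) p)
  rw [partialD, h1.fderiv_eq, fderiv_apply_coord h3.differentiableAt, h3.fderiv]
  simp

theorem deltaVec_stdVec_apply (g φ : RMetric m M) (e : OpenPartialHomeomorph M (Eu m)) (p : Eu m)
    (α β γ : Fin m) :
    deltaVec g φ e p (stdVec α) (stdVec β) γ = deltaSymbol g φ e γ α β p := by
  simp [deltaVec_apply, stdVec_apply]

theorem secondForm_apply (g φ : RMetric m M) (h : RMetric n N) {f : M → N}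
    (hf : ContDiffAt ℝ ∞ (mapIn e e' f) p) (α β : Fin m) (k : Fin n) :
    secondForm g φ h e e' f p (stdVec α) (stdVec β) k
      = partialD α (partialD β (mapCoord e e' f k)) p
        - ∑ γ, deltaSymbol g φ e γ α β p * partialD γ (mapCoord e e' f k) p
        + ∑ i, ∑ j, christoffel h e' k i j (e' (f (e.symm p)))
            * partialD α (mapCoord e e' f i) p * partialD β (mapCoord e e' f j) p := by
  simp only [secondForm, PiLp.add_apply, PiLp.sub_apply, christoffelVec_apply,
    partialD_partialD_mapCoord hf, partialD_mapCoord hf]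
  rw [clm_eq_sum _ (deltaVec g φ e p (stdVec α) (stdVec β))]
  simp only [deltaVec_stdVec_apply, WithLp.ofLp_sum, WithLp.ofLp_smul, Finset.sum_apply,
    Pi.smul_apply, smul_eq_mul]
  rfl

theorem harmonicMapEquations_of_geodesic (g φ : RMetric m M)
    (h : RMetric n N) {f : M → N} (hf : ContMDiff (𝓡 m) (𝓡 n) ∞ f)
    (hgeo : ∀ (J : Set ℝ) (c : ℝ → M), IsOpen J → J.OrdConnected →
      IsPairGeodesic g φ c J → IsGeodesic h (f ∘ c) J) :
    HarmonicMapEquations g φ h f := by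
  intro e he e' he' p hp hfp k
  have h1 := congrArg (fun v : Eu n => v k) (tension_eq_zero g φ h hf hgeo he he' hp hfp)
  simp only [tension, WithLp.ofLp_sum, WithLp.ofLp_smul, Finset.sum_apply,
    Pi.smul_apply, smul_eq_mul] at h1
  simp only [← secondForm_apply g φ h (contDiffAt_mapIn he he' hp hf.contMDiffAt hfp)]
  exact h1

end HarmonicEquations

/-! ### The weight `√φ` and the trace of `Δ`. -/

section Divergence

variable {m : ℕ} {M : Type*} [TopologicalSpace M] [ChartedSpace (Eu m) M]
  [IsManifold (𝓡 m) ∞ M] {e : OpenPartialHomeomorph M (Eu m)} {p : Eu m}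

/-- The density `√(det φ)` of the volume of `φ` in the chart `e`. -/
def volDensity (φ : RMetric m M) (e : OpenPartialHomeomorph M (Eu m)) (p : Eu m) : ℝ :=
  Real.sqrt (metricMatrix φ e p).det

theorem volDensity_pos (φ : RMetric m M) (he : IsChart e) (hp : p ∈ e.target) :
    0 < volDensity φ e p := Real.sqrt_pos.2 (metricMatrix_det_pos φ he hp)

theorem contDiffAt_volDensity (φ : RMetric m M) (he : IsChart e) (hp : p ∈ e.target) :
    ContDiffAt ℝ ∞ (volDensity φ e) p :=
  (contDiffAt_metricMatrix_det φ he hp).sqrt (metricMatrix_det_pos φ he hp).ne'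

/-- Since `ln √φ = ½ ln det g - ½ ln (det g / det φ)`, Jacobi's formula for `g` gives the
logarithmic derivative. It is expressed through `g` and the ratio because `Δ` is built from these.
-/
theorem partialD_volDensity (g φ : RMetric m M) (he : IsChart e) (hp : p ∈ e.target)
    (α : Fin m) :
    partialD α (volDensity φ e) p = volDensity φ e p * ((1 / 2) *
      (∑ i, ∑ j, (metricMatrix g e p)⁻¹ i j * partialD α (fun q => metricMatrix g e q j i) p
        - partialD α (logRatio g φ e) p)) := by
  have hg := metricMatrix_det_pos g he hp
  have hφ := metricMatrix_det_pos φ he hp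
  have hdg := ((contDiffAt_metricMatrix_det g he hp).differentiableAt (by simp)).hasFDerivAt
  have hdφ := ((contDiffAt_metricMatrix_det φ he hp).differentiableAt (by simp)).hasFDerivAt
  have h1 := (hdφ.sqrt hφ.ne').fderiv
  have hJ := fderiv_det (fun i j => (contDiffAt_metricMatrix g he hp i j).differentiableAt
    (by simp)) hg.ne' (stdVec α)
  have hL : logRatio g φ e =ᶠ[nhds p] fun q => Real.log (metricMatrix g e q).det
      - Real.log (metricMatrix φ e q).det := by
    filter_upwards [e.open_target.mem_nhds hp] with q hq
    exact Real.log_div (metricMatrix_det_pos g he hq).ne' (metricMatrix_det_pos φ he hq).ne'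
  have h2 := ((hdg.log hg.ne').sub (hdφ.log hφ.ne')).fderiv
  have h3 : partialD α (volDensity φ e) p = (1 / (2 * volDensity φ e p))
      * fderiv ℝ (fun q => (metricMatrix φ e q).det) p (stdVec α) :=
    congrArg (fun L : Eu m →L[ℝ] ℝ => L (stdVec α)) h1
  have h4 : partialD α (logRatio g φ e) p
      = (metricMatrix g e p).det⁻¹ * fderiv ℝ (fun q => (metricMatrix g e q).det) p (stdVec α)
        - (metricMatrix φ e p).det⁻¹
          * fderiv ℝ (fun q => (metricMatrix φ e q).det) p (stdVec α) := by
    rw [partialD, hL.fderiv_eq]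
    exact congrArg (fun L : Eu m →L[ℝ] ℝ => L (stdVec α)) h2
  rw [h3, h4, hJ]
  have hs := volDensity_pos φ he hp
  have hss : (metricMatrix φ e p).det = volDensity φ e p * volDensity φ e p :=
    (Real.mul_self_sqrt hφ.le).symm
  rw [hss]
  simp only [partialD_eq]
  field_simp
  ring

theorem partialD_mul {u v : Eu m → ℝ} (hu : DifferentiableAt ℝ u p) (hv : DifferentiableAt ℝ v p)
    (α : Fin m) :
    partialD α (fun q => u q * v q) p = partialD α u p * v p + u p * partialD α v p := by
  rw [partialD, fderiv_fun_mul hu hv]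
  simp [partialD]
  ring

/-- The coordinate expression of the trace of `Δ` as a divergence. -/
theorem sum_partialD_volDensity_mul_inv (g φ : RMetric m M) (he : IsChart e) (hp : p ∈ e.target)
    (β : Fin m) :
    ∑ α, partialD α (fun q => volDensity φ e q * (metricMatrix g e q)⁻¹ α β) p
      = -(volDensity φ e p * ∑ α, ∑ γ, (metricMatrix g e p)⁻¹ α γ * deltaSymbol g φ e β α γ p) := by
  have hG := metricMatrix_inv_symm g e p
  set G := (metricMatrix g e p)⁻¹
  set s := volDensity φ e p
  set D : Fin m → Fin m → Fin m → ℝ := fun α i j => partialD α (fun q => metricMatrix g e q i j) p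
    with hD
  have hDs : ∀ α i j, D α i j = D α j i := fun α i j => by
    simp only [hD, metricMatrix_apply, metricForm_symm g e _ (stdVec i)]
  have hinv : ∀ α, partialD α (fun q => (metricMatrix g e q)⁻¹ α β) p
      = -∑ k, ∑ l, G α k * D α k l * G l β := fun α =>
    fderiv_inv_apply (fun i j => (contDiffAt_metricMatrix g he hp i j).of_le (by norm_cast))
      (metricMatrix_det_pos g he hp).ne' _ _ _
  have h1 : ∀ α, partialD α (fun q => volDensity φ e q * (metricMatrix g e q)⁻¹ α β) p
      = s * ((1 / 2) * (∑ i, ∑ j, G i j * D α j i - partialD α (logRatio g φ e) p)) * G α β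
        + s * -∑ k, ∑ l, G α k * D α k l * G l β := fun α => by
    rw [partialD_mul ((contDiffAt_volDensity φ he hp).differentiableAt (by simp))
      ((contDiffAt_metricMatrix_inv g he hp α β).differentiableAt (by simp)),
      partialD_volDensity g φ he hp, hinv]
  have h2 : ∀ α γ, deltaSymbol g φ e β α γ p
      = (1 / 2) * ∑ σ, G β σ * (D α σ γ + D γ σ α - D σ α γ)
        + (1 / 2) * partialD α (logRatio g φ e) p * (if β = γ then 1 else 0) := fun α γ => rfl
  -- Relabelling leaves two triple sums: `T₁` with `D α σ γ` and `T₂` with `D σ α γ`. With `L = ∑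
  -- ∂_α(logRatio) G α β`, the trace of `Δ` is `T₁ - ½ T₂ + ½ L` and the divergence is `s (½ T₂ - ½
  -- L - T₁)`.
  have e1 : ∑ α, ∑ γ, ∑ σ, G α γ * (G β σ * D γ σ α) = ∑ α, ∑ γ, ∑ σ, G α γ * (G β σ * D α σ γ) := by
    rw [Finset.sum_comm]
    exact Finset.sum_congr rfl fun a _ => Finset.sum_congr rfl fun b _ =>
      Finset.sum_congr rfl fun c _ => by rw [hG a b]
  have e2 : ∑ α, ∑ k, ∑ l, G α k * D α k l * G l β
      = ∑ α, ∑ γ, ∑ σ, G α γ * (G β σ * D α σ γ) := by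
    exact Finset.sum_congr rfl fun a _ => Finset.sum_congr rfl fun b _ =>
      Finset.sum_congr rfl fun c _ => by rw [hG c β, hDs a b c]; ring
  have e3 : ∑ α, (∑ i, ∑ j, G i j * D α j i) * G α β
      = ∑ α, ∑ γ, ∑ σ, G α γ * (G β σ * D σ α γ) := by
    simp only [Finset.sum_mul]
    rw [Finset.sum_comm]
    refine Finset.sum_congr rfl fun a _ => ?_
    rw [Finset.sum_comm]
    exact Finset.sum_congr rfl fun b _ => Finset.sum_congr rfl fun c _ => by
      rw [hG c β, hDs c b a]; ring
  have e4 : ∑ α, ∑ γ, G α γ * ((1 / 2) * partialD α (logRatio g φ e) p * (if β = γ then 1 else 0))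
      = (1 / 2) * ∑ α, partialD α (logRatio g φ e) p * G α β := by
    rw [Finset.mul_sum]
    refine Finset.sum_congr rfl fun a _ => ?_
    simp
    ring
  have e5 : ∑ α, ∑ γ, G α γ * ((1 / 2) * ∑ σ, G β σ * (D α σ γ + D γ σ α - D σ α γ))
      = (1 / 2) * (∑ α, ∑ γ, ∑ σ, G α γ * (G β σ * D α σ γ)
        + ∑ α, ∑ γ, ∑ σ, G α γ * (G β σ * D γ σ α)
        - ∑ α, ∑ γ, ∑ σ, G α γ * (G β σ * D σ α γ)) := by
    simp only [← Finset.sum_add_distrib, ← Finset.sum_sub_distrib, Finset.mul_sum]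
    exact Finset.sum_congr rfl fun a _ => Finset.sum_congr rfl fun b _ =>
      Finset.sum_congr rfl fun c _ => by ring
  have e6 : ∑ α, (s * ((1 / 2) * (∑ i, ∑ j, G i j * D α j i - partialD α (logRatio g φ e) p))
        * G α β + s * -∑ k, ∑ l, G α k * D α k l * G l β)
      = s * ((1 / 2) * (∑ α, (∑ i, ∑ j, G i j * D α j i) * G α β)
        - (1 / 2) * ∑ α, partialD α (logRatio g φ e) p * G α β
        - ∑ α, ∑ k, ∑ l, G α k * D α k l * G l β) := by
    rw [Finset.mul_sum, Finset.mul_sum, ← Finset.sum_sub_distrib, ← Finset.sum_sub_distrib,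
      Finset.mul_sum]
    exact Finset.sum_congr rfl fun a _ => by ring
  have e7 : ∑ α, ∑ γ, G α γ * deltaSymbol g φ e β α γ p
      = ∑ α, ∑ γ, G α γ * ((1 / 2) * ∑ σ, G β σ * (D α σ γ + D γ σ α - D σ α γ))
        + ∑ α, ∑ γ, G α γ
          * ((1 / 2) * partialD α (logRatio g φ e) p * (if β = γ then 1 else 0)) := by
    simp only [h2, mul_add, Finset.sum_add_distrib]
  rw [Finset.sum_congr rfl fun α _ => h1 α, e6, e7, e4, e5, e1, e2, e3]
  ring

end Divergence

/-! ### The pointwise first variation of the energy density. -/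

section Variation

variable {m n : ℕ} {M : Type*} [TopologicalSpace M] [ChartedSpace (Eu m) M]
  [IsManifold (𝓡 m) ∞ M] {N : Type*} [TopologicalSpace N] [ChartedSpace (Eu n) N]
  [IsManifold (𝓡 n) ∞ N] {e : OpenPartialHomeomorph M (Eu m)}
  {e' : OpenPartialHomeomorph N (Eu n)} {p : Eu m}

/-- The variation `F` in the charts `e` and `e'`. -/
def varIn (e : OpenPartialHomeomorph M (Eu m)) (e' : OpenPartialHomeomorph N (Eu n))
    (F : ℝ → M → N) (z : ℝ × Eu m) : Eu n := e' (F z.1 (e.symm z.2))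

/-- The variation `F` is jointly smooth. -/
abbrev SmoothVariation (m n : ℕ) {M N : Type*} [TopologicalSpace M] [ChartedSpace (Eu m) M]
    [TopologicalSpace N] [ChartedSpace (Eu n) N] (F : ℝ → M → N) : Prop :=
  ContMDiff (𝓘(ℝ, ℝ).prod (𝓡 m)) (𝓡 n) ∞ (fun z : ℝ × M => F z.1 z.2)

variable {F : ℝ → M → N}

theorem SmoothVariation.contMDiff_apply (hF : SmoothVariation m n F) (t : ℝ) :
    ContMDiff (𝓡 m) (𝓡 n) ∞ (F t) :=
  hF.comp (contMDiff_const.prodMk contMDiff_id)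

theorem SmoothVariation.contMDiff_curve (hF : SmoothVariation m n F) (a : M) :
    ContMDiff 𝓘(ℝ, ℝ) (𝓡 n) ∞ (fun t => F t a) :=
  hF.comp (contMDiff_id.prodMk contMDiff_const)

theorem SmoothVariation.contMDiffAt_chart (hF : SmoothVariation m n F) (he : IsChart e)
    {z : ℝ × Eu m} (hz : z.2 ∈ e.target) :
    ContMDiffAt 𝓘(ℝ, ℝ × Eu m) (𝓡 n) ∞ (fun z : ℝ × Eu m => F z.1 (e.symm z.2)) z := by
  have h1 : ContMDiffAt 𝓘(ℝ, ℝ × Eu m) 𝓘(ℝ, ℝ) ∞ (fun z : ℝ × Eu m => z.1) z :=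
    contDiffAt_fst.contMDiffAt
  have h2 : ContMDiffAt 𝓘(ℝ, ℝ × Eu m) (𝓡 m) ∞ (fun z : ℝ × Eu m => z.2) z :=
    contDiffAt_snd.contMDiffAt
  exact (hF (z.1, e.symm z.2)).comp z
    (h1.prodMk (ContMDiffAt.comp (g := e.symm) z (he.contMDiffAt_symm hz) h2))

theorem SmoothVariation.contDiffAt_varIn (hF : SmoothVariation m n F) (he : IsChart e)
    (he' : IsChart e') {z : ℝ × Eu m} (hz : z.2 ∈ e.target)
    (hz' : F z.1 (e.symm z.2) ∈ e'.source) : ContDiffAt ℝ ∞ (varIn e e' F) z :=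
  (ContMDiffAt.comp z (he'.contMDiffAt hz') (hF.contMDiffAt_chart he hz)).contDiffAt

theorem SmoothVariation.eventually_mem (hF : SmoothVariation m n F) (he : IsChart e)
    {z : ℝ × Eu m} (hz : z.2 ∈ e.target)
    (hz' : F z.1 (e.symm z.2) ∈ e'.source) :
    ∀ᶠ y : ℝ × Eu m in nhds z, y.2 ∈ e.target ∧ F y.1 (e.symm y.2) ∈ e'.source :=
  (continuousAt_snd.eventually_mem (e.open_target.mem_nhds hz)).and
    ((hF.contMDiffAt_chart he hz).continuousAt.eventually_mem (e'.open_source.mem_nhds hz'))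

theorem hasFDerivAt_mapIn {t : ℝ} {L : ℝ × Eu m →L[ℝ] Eu n}
    (h : HasFDerivAt (varIn e e' F) L (t, p)) :
    HasFDerivAt (mapIn e e' (F t)) (L.comp (ContinuousLinearMap.inr ℝ ℝ (Eu m))) p :=
  h.comp p (hasFDerivAt_prodMk_right t p)

theorem fderiv_mapIn {t : ℝ} (h : DifferentiableAt ℝ (varIn e e' F) (t, p)) (u : Eu m) :
    fderiv ℝ (mapIn e e' (F t)) p u = fderiv ℝ (varIn e e' F) (t, p) (0, u) :=
  congrArg (fun L : Eu m →L[ℝ] Eu n => L u) (hasFDerivAt_mapIn h.hasFDerivAt).fderiv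

/-- Spatial derivatives become derivatives on `ℝ × ℝᵐ`, so that the symmetry of one second
derivative covers the mixed time-space terms as well. -/
theorem fderiv_fderiv_mapIn {t : ℝ} (h : ContDiffAt ℝ ∞ (varIn e e' F) (t, p)) (u v : Eu m) :
    fderiv ℝ (fderiv ℝ (mapIn e e' (F t))) p u v
      = fderiv ℝ (fderiv ℝ (varIn e e' F)) (t, p) (0, u) (0, v) := by
  have h1 : ∀ᶠ q in nhds p, DifferentiableAt ℝ (varIn e e' F) (t, q) :=
    (hasFDerivAt_prodMk_right (𝕜 := ℝ) t p).continuousAt.eventually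
      (((h.of_le (m := 1) (by norm_cast)).eventually (by simp)).mono
        fun z hz => hz.differentiableAt one_ne_zero)
  have h2 : fderiv ℝ (mapIn e e' (F t)) =ᶠ[nhds p]
      fun q => (fderiv ℝ (varIn e e' F) (t, q)).comp (ContinuousLinearMap.inr ℝ ℝ (Eu m)) := by
    filter_upwards [h1] with q hq
    exact (hasFDerivAt_mapIn hq.hasFDerivAt).fderiv
  have h3 : HasFDerivAt (fderiv ℝ (varIn e e' F)) _ (t, p) :=
    ((h.fderiv_right (m := 1) (by norm_cast)).differentiableAt one_ne_zero).hasFDerivAt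
  have h4 := (h3.comp p (hasFDerivAt_prodMk_right t p)).clm_comp
    (hasFDerivAt_const (ContinuousLinearMap.inr ℝ ℝ (Eu m)) p)
  rw [h2.fderiv_eq]
  have h5 := congrArg (fun L : Eu m →L[ℝ] Eu m →L[ℝ] Eu n => L u v) h4.fderiv
  refine h5.trans ?_
  simp

/-- The scalar product of the derivatives of the variation in the directions `a` and `b`. -/
def pairIn (h : RMetric n N) (e : OpenPartialHomeomorph M (Eu m))
    (e' : OpenPartialHomeomorph N (Eu n)) (F : ℝ → M → N) (a b z : ℝ × Eu m) : ℝ :=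
  metricForm h e' (varIn e e' F z) (fderiv ℝ (varIn e e' F) z a) (fderiv ℝ (varIn e e' F) z b)

theorem contDiffAt_pairIn (h : RMetric n N) (hF : SmoothVariation m n F) (he : IsChart e)
    (he' : IsChart e') {z : ℝ × Eu m} (hz : z.2 ∈ e.target)
    (hz' : F z.1 (e.symm z.2) ∈ e'.source) (a b : ℝ × Eu m) :
    ContDiffAt ℝ ∞ (pairIn h e e' F a b) z := by
  have h0 := hF.contDiffAt_varIn he he' hz hz'
  have h1 := h0.fderiv_right (m := ∞) (by simp)
  have h2 := (he'.contDiffAt_metricForm h (e'.map_source hz')).comp z h0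
  exact (h2.clm_apply (h1.clm_apply contDiffAt_const)).clm_apply (h1.clm_apply contDiffAt_const)

theorem fderiv_pairIn (h : RMetric n N) (hF : SmoothVariation m n F) (he : IsChart e)
    (he' : IsChart e') {z : ℝ × Eu m} (hz : z.2 ∈ e.target)
    (hz' : F z.1 (e.symm z.2) ∈ e'.source) (a b w : ℝ × Eu m) :
    fderiv ℝ (pairIn h e e' F a b) z w
      = metricDeriv h e' (varIn e e' F z) (fderiv ℝ (varIn e e' F) z w)
          (fderiv ℝ (varIn e e' F) z a) (fderiv ℝ (varIn e e' F) z b)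
        + metricForm h e' (varIn e e' F z) (fderiv ℝ (fderiv ℝ (varIn e e' F)) z w a)
          (fderiv ℝ (varIn e e' F) z b)
        + metricForm h e' (varIn e e' F z) (fderiv ℝ (varIn e e' F) z a)
          (fderiv ℝ (fderiv ℝ (varIn e e' F)) z w b) := by
  have h0 := hF.contDiffAt_varIn he he' hz hz'
  have h1 : HasFDerivAt (varIn e e' F) _ z := (h0.differentiableAt (by simp)).hasFDerivAt
  have h2 : HasFDerivAt (fderiv ℝ (varIn e e' F)) _ z :=
    ((h0.fderiv_right (m := 1) (by norm_cast)).differentiableAt one_ne_zero).hasFDerivAt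
  have h3 := (hasFDerivAt_metricForm h he' (e'.map_source hz')).comp z h1
  have h4 := (h3.clm_apply (h2.clm_apply (hasFDerivAt_const a z))).clm_apply
    (h2.clm_apply (hasFDerivAt_const b z))
  refine (congrArg (fun L : ℝ × Eu m →L[ℝ] ℝ => L w) h4.fderiv).trans ?_
  simp
  rw [show e' (F z.1 (e.symm z.2)) = varIn e e' F z from rfl]
  ring

/-- The Gram matrix uses the preferred chart at each point, which may jump with the point. In the
frame of one fixed chart the trace has smooth coefficients. -/
theorem sum_gramMatrix_inv (g : RMetric m M) (he : IsChart e) (hp : p ∈ e.target)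
    (A : Eu m →L[ℝ] Eu m →L[ℝ] ℝ) :
    ∑ α, ∑ β, (gramMatrix g (e.symm p))⁻¹ α β * A (stdVec α) (stdVec β)
      = ∑ α, ∑ β, (metricMatrix g e p)⁻¹ α β
        * A (chartFrame e p (stdVec α)) (chartFrame e p (stdVec β)) := by
  obtain ⟨D, hD, -⟩ := exists_chartFrame_inverse he hp
  exact (sum_inv_formMatrix hD (innerForm g (e.symm p)) A).symm

theorem energyDensity_eq (g : RMetric m M) (h : RMetric n N) (hF : SmoothVariation m n F)
    (he : IsChart e) (he' : IsChart e') {z : ℝ × Eu m} (hz : z.2 ∈ e.target)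
    (hz' : F z.1 (e.symm z.2) ∈ e'.source) :
    energyDensity g h (F z.1) (e.symm z.2)
      = ∑ α, ∑ β, (metricMatrix g e z.2)⁻¹ α β * pairIn h e e' F (0, stdVec α) (0, stdVec β) z := by
  have h1 := sum_gramMatrix_inv g he hz ((innerForm h (F z.1 (e.symm z.2))).bilinearComp
    (mapDeriv (F z.1) (e.symm z.2)) (mapDeriv (F z.1) (e.symm z.2)))
  refine Eq.trans ?_ (h1.trans ?_)
  · rfl
  refine Finset.sum_congr rfl fun α _ => Finset.sum_congr rfl fun β _ => ?_
  have hs : e'.symm (mapIn e e' (F z.1) z.2) = F z.1 (e.symm z.2) := e'.left_inv hz'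
  have hd := (hF.contDiffAt_varIn he he' hz hz').differentiableAt (by simp)
  rw [ContinuousLinearMap.bilinearComp_apply,
    mapDeriv_chartFrame he he' hz (hF.contMDiff_apply _).contMDiffAt hz',
    mapDeriv_chartFrame he he' hz (hF.contMDiff_apply _).contMDiffAt hz', ← hs,
    ← metricForm_apply, fderiv_mapIn hd, fderiv_mapIn hd]
  rfl

theorem contDiffAt_energyDensity (g : RMetric m M) (h : RMetric n N) (hF : SmoothVariation m n F)
    (he : IsChart e) {z : ℝ × Eu m} (hz : z.2 ∈ e.target) :
    ContDiffAt ℝ ∞ (fun z : ℝ × Eu m => energyDensity g h (F z.1) (e.symm z.2)) z := by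
  obtain ⟨e', he', hz'⟩ : ∃ e' : OpenPartialHomeomorph N (Eu n), IsChart e' ∧
      F z.1 (e.symm z.2) ∈ e'.source := ⟨_, isChart_chartAt _, mem_chart_source (Eu n) _⟩
  have h1 : ContDiffAt ℝ ∞ (fun z : ℝ × Eu m => ∑ α, ∑ β, (metricMatrix g e z.2)⁻¹ α β
      * pairIn h e e' F (0, stdVec α) (0, stdVec β) z) z :=
    ContDiffAt.sum fun α _ => ContDiffAt.sum fun β _ =>
      ((contDiffAt_metricMatrix_inv g he hz α β).comp z contDiffAt_snd).mul
        (contDiffAt_pairIn h hF he he' hz hz' _ _)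
  refine h1.congr_of_eventuallyEq ?_
  filter_upwards [hF.eventually_mem he hz hz'] with y hy
  exact energyDensity_eq g h hF he he' hy.1 hy.2

/-- The variation field of `F`. -/
def varField (F : ℝ → M → N) (a : M) : Eu n := mfderiv 𝓘(ℝ, ℝ) (𝓡 n) (fun t => F t a) 0 (1 : ℝ)

theorem varField_eq (hF : SmoothVariation m n F) (he : IsChart e) (he' : IsChart e')
    (hp : p ∈ e.target) (hp' : F 0 (e.symm p) ∈ e'.source) :
    varField F (e.symm p)
      = chartFrame e' (varIn e e' F (0, p)) (fderiv ℝ (varIn e e' F) (0, p) (1, 0)) := by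
  have h0 : (∞ : WithTop ℕ∞) ≠ 0 := by simp
  have hd : HasFDerivAt (varIn e e' F) _ (0, p) :=
    ((hF.contDiffAt_varIn he he' (z := (0, p)) hp hp').differentiableAt h0).hasFDerivAt
  have hc := hd.comp (0 : ℝ) (hasFDerivAt_prodMk_left (𝕜 := ℝ) (0 : ℝ) p)
  have hs' := (he'.contMDiffAt_symm (e'.map_source hp')).mdifferentiableAt h0
  have h1 : (fun t => F t (e.symm p)) =ᶠ[nhds 0] e'.symm ∘ fun t => varIn e e' F (t, p) := by
    filter_upwards [(hF.contMDiff_curve (e.symm p)).continuous.continuousAt.preimage_mem_nhds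
      (e'.open_source.mem_nhds hp')] with t ht
    exact (e'.left_inv ht).symm
  have h2 : mfderiv 𝓘(ℝ, ℝ) (𝓡 n) (e'.symm ∘ fun t => varIn e e' F (t, p)) 0
      = (mfderiv (𝓡 n) (𝓡 n) e'.symm (varIn e e' F (0, p))).comp
        (mfderiv 𝓘(ℝ, ℝ) (𝓡 n) (fun t => varIn e e' F (t, p)) 0) :=
    mfderiv_comp (0 : ℝ) hs' hc.differentiableAt.mdifferentiableAt
  have h3 : mfderiv 𝓘(ℝ, ℝ) (𝓡 n) (fun t => varIn e e' F (t, p)) 0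
      = fderiv ℝ (fun t => varIn e e' F (t, p)) 0 := mfderiv_eq_fderiv
  have h4 := h1.mfderiv_eq.trans h2
  rw [h3] at h4
  have h5 : fderiv ℝ (fun t => varIn e e' F (t, p)) 0 (1 : ℝ)
      = fderiv ℝ (varIn e e' F) (0, p) (1, 0) :=
    congrArg (fun L : ℝ →L[ℝ] Eu n => L 1) hc.fderiv
  rw [← h5]
  exact congrArg (fun L : ℝ →L[ℝ] Eu n => L 1) h4

/-- The components `g^{αβ} h(W, f_β)` in the chart `e`, where `W` is the variation field. -/
def flux (g : RMetric m M) (h : RMetric n N) (F : ℝ → M → N) (e : OpenPartialHomeomorph M (Eu m))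
    (α : Fin m) (p : Eu m) : ℝ :=
  ∑ β, (metricMatrix g e p)⁻¹ α β * innerForm h (F 0 (e.symm p)) (varField F (e.symm p))
    (mapDeriv (F 0) (e.symm p) (chartFrame e p (stdVec β)))

theorem flux_eq (g : RMetric m M) (h : RMetric n N) (hF : SmoothVariation m n F)
    (he : IsChart e) (he' : IsChart e') (hp : p ∈ e.target) (hp' : F 0 (e.symm p) ∈ e'.source)
    (α : Fin m) :
    flux g h F e α p
      = ∑ β, (metricMatrix g e p)⁻¹ α β * pairIn h e e' F (1, 0) (0, stdVec β) (0, p) := by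
  refine Finset.sum_congr rfl fun β _ => ?_
  have hs : e'.symm (mapIn e e' (F 0) p) = F 0 (e.symm p) := e'.left_inv hp'
  have hd := (hF.contDiffAt_varIn he he' (z := (0, p)) hp hp').differentiableAt (by simp)
  rw [mapDeriv_chartFrame he he' hp (hF.contMDiff_apply _).contMDiffAt hp',
    varField_eq hF he he' hp hp', ← hs, fderiv_mapIn hd]
  rfl

/-- The image of the chart domain need not lie in one chart of `N`. The flux is defined without such
a chart, and smoothness is checked locally in a chart around the image point. -/
theorem contDiffAt_flux (g : RMetric m M) (h : RMetric n N) (hF : SmoothVariation m n F)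
    (he : IsChart e) (hp : p ∈ e.target) (α : Fin m) : ContDiffAt ℝ ∞ (flux g h F e α) p := by
  obtain ⟨e', he', hp'⟩ : ∃ e' : OpenPartialHomeomorph N (Eu n), IsChart e' ∧
      F 0 (e.symm p) ∈ e'.source := ⟨_, isChart_chartAt _, mem_chart_source (Eu n) _⟩
  have h1 : ContDiffAt ℝ ∞ (fun q => ∑ β, (metricMatrix g e q)⁻¹ α β
      * pairIn h e e' F (1, 0) (0, stdVec β) (0, q)) p :=
    ContDiffAt.sum fun β _ => (contDiffAt_metricMatrix_inv g he hp α β).mul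
      ((contDiffAt_pairIn h hF he he' (z := (0, p)) hp hp' _ _).comp p
        (contDiffAt_const.prodMk contDiffAt_id))
  refine h1.congr_of_eventuallyEq ?_
  filter_upwards [(hasFDerivAt_prodMk_right (𝕜 := ℝ) (0 : ℝ) p).continuousAt.eventually
    (hF.eventually_mem he (z := (0, p)) hp hp')] with q hq
  exact flux_eq g h hF he he' hq.1 hq.2 α

theorem deriv_energyDensity (g : RMetric m M) (h : RMetric n N) (hF : SmoothVariation m n F)
    (he : IsChart e) (he' : IsChart e') (hp : p ∈ e.target) (hp' : F 0 (e.symm p) ∈ e'.source) :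
    deriv (fun t => energyDensity g h (F t) (e.symm p)) 0
      = ∑ α, ∑ β, (metricMatrix g e p)⁻¹ α β
        * fderiv ℝ (pairIn h e e' F (0, stdVec α) (0, stdVec β)) (0, p) (1, 0) := by
  have hz : ((0 : ℝ), p).2 ∈ e.target := hp
  have h1 : (fun t => energyDensity g h (F t) (e.symm p)) =ᶠ[nhds 0] fun t =>
      ∑ α, ∑ β, (metricMatrix g e p)⁻¹ α β
        * pairIn h e e' F (0, stdVec α) (0, stdVec β) (t, p) := by
    filter_upwards [(hasFDerivAt_prodMk_left (𝕜 := ℝ) (0 : ℝ) p).continuousAt.eventually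
      (hF.eventually_mem he hz hp')] with t ht
    exact energyDensity_eq g h hF he he' (z := (t, p)) ht.1 ht.2
  rw [h1.deriv_eq]
  refine HasDerivAt.deriv (HasDerivAt.fun_sum fun α _ => HasDerivAt.fun_sum fun β _ =>
    HasDerivAt.const_mul _ ?_)
  have h2 : HasFDerivAt (pairIn h e e' F (0, stdVec α) (0, stdVec β)) _ (0, p) :=
    ((contDiffAt_pairIn h hF he he' hz hp' (0, stdVec α)
      (0, stdVec β)).differentiableAt (by simp)).hasFDerivAt
  have h3 := h2.comp (0 : ℝ) (hasFDerivAt_prodMk_left (𝕜 := ℝ) (0 : ℝ) p)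
  have h4 := h3.hasDerivAt
  simp only [ContinuousLinearMap.comp_apply, ContinuousLinearMap.inl_apply] at h4
  exact h4

/-- In the product rule `√φ g^{αβ}` is kept as one factor, so that its divergence turns into the
trace of `Δ`. -/
theorem sum_partialD_volDensity_flux (g φ : RMetric m M) (h : RMetric n N)
    (hF : SmoothVariation m n F) (he : IsChart e) (he' : IsChart e') (hp : p ∈ e.target)
    (hp' : F 0 (e.symm p) ∈ e'.source) :
    ∑ α, partialD α (fun q => volDensity φ e q * flux g h F e α q) p
      = -(volDensity φ e p * ∑ β, (∑ α, ∑ γ, (metricMatrix g e p)⁻¹ α γ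
            * deltaSymbol g φ e β α γ p) * pairIn h e e' F (1, 0) (0, stdVec β) (0, p))
        + volDensity φ e p * ∑ α, ∑ β, (metricMatrix g e p)⁻¹ α β
          * fderiv ℝ (pairIn h e e' F (1, 0) (0, stdVec β)) (0, p) (0, stdVec α) := by
  have hz : ((0 : ℝ), p).2 ∈ e.target := hp
  have hc : ∀ β, HasFDerivAt (fun q => pairIn h e e' F (1, 0) (0, stdVec β) (0, q))
      ((fderiv ℝ (pairIn h e e' F (1, 0) (0, stdVec β)) (0, p)).comp
        (ContinuousLinearMap.inr ℝ ℝ (Eu m))) p := fun β =>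
    ((contDiffAt_pairIn h hF he he' hz hp' (1, 0)
      (0, stdVec β)).differentiableAt (by simp)).hasFDerivAt.comp p
      (hasFDerivAt_prodMk_right (0 : ℝ) p)
  have hs : ∀ α β, DifferentiableAt ℝ
      (fun q => volDensity φ e q * (metricMatrix g e q)⁻¹ α β) p := fun α β =>
    ((contDiffAt_volDensity φ he hp).mul (contDiffAt_metricMatrix_inv g he hp α β)).differentiableAt
      (by simp)
  have h1 : ∀ α, partialD α (fun q => volDensity φ e q * flux g h F e α q) p
      = ∑ β, (partialD α (fun q => volDensity φ e q * (metricMatrix g e q)⁻¹ α β) p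
          * pairIn h e e' F (1, 0) (0, stdVec β) (0, p)
        + volDensity φ e p * ((metricMatrix g e p)⁻¹ α β
          * fderiv ℝ (pairIn h e e' F (1, 0) (0, stdVec β)) (0, p) (0, stdVec α))) := by
    intro α
    have h2 : (fun q => volDensity φ e q * flux g h F e α q) =ᶠ[nhds p] fun q => ∑ β,
        (volDensity φ e q * (metricMatrix g e q)⁻¹ α β)
          * pairIn h e e' F (1, 0) (0, stdVec β) (0, q) := by
      filter_upwards [(hasFDerivAt_prodMk_right (𝕜 := ℝ) (0 : ℝ) p).continuousAt.eventually
        (hF.eventually_mem he hz hp')] with q hq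
      rw [flux_eq g h hF he he' hq.1 hq.2 α, Finset.mul_sum]
      exact Finset.sum_congr rfl fun β _ => (mul_assoc _ _ _).symm
    rw [partialD, h2.fderiv_eq, fderiv_fun_sum fun β _ => (hs α β).fun_mul (hc β).differentiableAt,
      _root_.sum_apply]
    refine Finset.sum_congr rfl fun β _ => ?_
    rw [← partialD_eq, partialD_mul (hs α β) (hc β).differentiableAt, partialD_eq α (fun q =>
      pairIn h e e' F (1, 0) (0, stdVec β) (0, q)), (hc β).fderiv]
    simp [mul_assoc]
  simp only [h1, Finset.sum_add_distrib]
  congr 1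
  · rw [Finset.sum_comm]
    simp only [← Finset.sum_mul, sum_partialD_volDensity_mul_inv g φ he hp]
    rw [Finset.mul_sum, ← Finset.sum_neg_distrib]
    exact Finset.sum_congr rfl fun β _ => by ring
  · simp only [Finset.mul_sum]

/-- The local form of the first variation formula, at the zeros of the tension field. -/
theorem sum_partialD_flux (g φ : RMetric m M) (h : RMetric n N) (hF : SmoothVariation m n F)
    (he : IsChart e) (he' : IsChart e') (hp : p ∈ e.target) (hp' : F 0 (e.symm p) ∈ e'.source)
    (ht : tension g φ h e e' (F 0) p = 0) :
    ∑ α, partialD α (fun q => volDensity φ e q * flux g h F e α q) p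
      = volDensity φ e p
        * ((1 / 2) * deriv (fun t => energyDensity g h (F t) (e.symm p)) 0) := by
  have hz : ((0 : ℝ), p).2 ∈ e.target := hp
  have hΨ := hF.contDiffAt_varIn he he' hz hp'
  have hd := hΨ.differentiableAt (by simp)
  have hsymm := fderiv_fderiv_symm hΨ
  have hG := metricMatrix_inv_symm g e p
  have hm : varIn e e' F (0, p) = mapIn e e' (F 0) p := rfl
  have hy : varIn e e' F (0, p) ∈ e'.target := e'.map_source hp'
  rw [deriv_energyDensity g h hF he he' hp hp', sum_partialD_volDensity_flux g φ h hF he he' hp hp']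
  simp only [fderiv_pairIn h hF he he' hz hp', pairIn]
  simp only [tension, secondForm, fderiv_fderiv_mapIn hΨ, fderiv_mapIn hd, ← hm] at ht
  set y := varIn e e' F (0, p)
  set D := fderiv ℝ (varIn e e' F) (0, p)
  set A := fderiv ℝ (fderiv ℝ (varIn e e' F)) (0, p)
  set G := (metricMatrix g e p)⁻¹
  set B := metricForm h e' y with hB
  have hBs : ∀ u v, B u v = B v u := metricForm_symm h e' y
  set X : Fin m → ℝ × Eu m := fun α => (0, stdVec α) with hX
  set T : ℝ × Eu m := (1, 0)
  have swap : ∀ c : Fin m → Fin m → ℝ, ∑ α, ∑ β, G α β * c β α = ∑ α, ∑ β, G α β * c α β := by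
    intro c
    rw [Finset.sum_comm]
    exact Finset.sum_congr rfl fun i _ => Finset.sum_congr rfl fun j _ => by rw [hG]
  set S1 := ∑ α, ∑ β, G α β * metricDeriv h e' y (D T) (D (X α)) (D (X β)) with hS1
  set S2 := ∑ α, ∑ β, G α β * B (A T (X α)) (D (X β)) with hS2
  set S3 := ∑ α, ∑ β, G α β * metricDeriv h e' y (D (X α)) (D T) (D (X β)) with hS3
  set S4 := ∑ α, ∑ β, G α β * B (D T) (A (X α) (X β)) with hS4
  set S5 := ∑ α, ∑ β, G α β * B (D T) (D (0, deltaVec g φ e p (stdVec α) (stdVec β))) with hS5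
  have hS2' : ∑ α, ∑ β, G α β * B (D (X α)) (A T (X β)) = S2 := by
    rw [hS2, ← swap]
    simp only [hBs (D _)]
  -- The tension paired with the variation field `D T`: the Hessian gives `S4`, the `Δ` term `S5`,
  -- and the Koszul formula turns the Christoffel term into first derivatives of `h`.
  have hten : S4 - S5 + (1 / 2) * (S3 + S3 - S1) = 0 := by
    have h1 := congrArg (B (D T)) ht
    have h2 : ∀ u v : Eu n, B (D T) (christoffelVec h e' y u v)
        = (1 / 2) * (metricDeriv h e' y u (D T) v + metricDeriv h e' y v (D T) u
          - metricDeriv h e' y (D T) u v) := fun u v => by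
      rw [hBs, hB, metricForm_christoffelVec h he' hy, metricDeriv_symm h he' hy v,
        metricDeriv_symm h he' hy u]
    have hS3' : ∑ α, ∑ β, G α β * metricDeriv h e' y (D (X β)) (D T) (D (X α)) = S3 :=
      swap fun α β => metricDeriv h e' y (D (X α)) (D T) (D (X β))
    simp only [map_sum, map_smul, map_add, map_sub, map_zero, smul_eq_mul, h2] at h1
    rw [← h1]
    nth_rewrite 2 [← hS3']
    rw [hS4, hS5, hS3, hS1]
    simp only [← Finset.sum_add_distrib, ← Finset.sum_sub_distrib, Finset.mul_sum]
    exact Finset.sum_congr rfl fun a _ => Finset.sum_congr rfl fun b _ => by ring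
  have hS5' : ∑ β, (∑ α, ∑ γ, G α γ * deltaSymbol g φ e β α γ p) * B (D T) (D (X β)) = S5 := by
    have h1 : ∀ v : Eu m, B (D T) (D (0, v)) = ∑ β, v β * B (D T) (D (X β)) := fun v =>
      clm_eq_sum (((B (D T)).comp D).comp (ContinuousLinearMap.inr ℝ ℝ (Eu m))) v
    simp only [hS5, h1, deltaVec_stdVec_apply, Finset.sum_mul, Finset.mul_sum]
    rw [Finset.sum_comm]
    refine Finset.sum_congr rfl fun a _ => ?_
    rw [Finset.sum_comm]
    exact Finset.sum_congr rfl fun b _ => Finset.sum_congr rfl fun c _ => by ring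
  have hL : ∑ α, ∑ β, G α β * (metricDeriv h e' y (D T) (D (X α)) (D (X β))
      + B (A T (X α)) (D (X β)) + B (D (X α)) (A T (X β))) = S1 + S2 + S2 := by
    nth_rewrite 2 [← hS2']
    simp only [hS1, hS2, mul_add, Finset.sum_add_distrib]
  -- Time and space derivatives commute, so the mixed term here is the same `S2` as in the
  -- derivative of the density.
  have hR : ∑ α, ∑ β, G α β * (metricDeriv h e' y (D (X α)) (D T) (D (X β))
      + B (A (X α) T) (D (X β)) + B (D T) (A (X α) (X β))) = S3 + S2 + S4 := by
    simp only [hS2, hS3, hS4, mul_add, Finset.sum_add_distrib, fun α => hsymm T (X α)]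
  rw [hL, hR, hS5']
  -- What remains is `S3 + S2 + S4 - S5 = ½ (S1 + 2 S2)`, weighted by `√φ`.
  linear_combination (volDensity φ e p) * hten

end Variation

/-! ### Change of charts, integration by parts and differentiation under the integral. -/

section Integration

open MeasureTheory

variable {m : ℕ} {M : Type*} [TopologicalSpace M] [ChartedSpace (Eu m) M]
  [IsManifold (𝓡 m) ∞ M] {e e' : OpenPartialHomeomorph M (Eu m)} {r : M → ℝ}

theorem volDensity_transition (φ : RMetric m M) (he : IsChart e) (he' : IsChart e') {p : Eu m}
    (hp : p ∈ e.target) (hp' : e.symm p ∈ e'.source) :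
    volDensity φ e p = |(fderiv ℝ (transition e e') p).det|
      * volDensity φ e' (transition e e' p) := by
  rw [volDensity, metricMatrix_det_transition φ he he' hp hp', Real.sqrt_mul (sq_nonneg _),
    Real.sqrt_sq_eq_abs]
  rfl

/-- The Riemannian integral can be computed in any chart. -/
theorem integral_chart_eq (φ : RMetric m M) (he : IsChart e) (he' : IsChart e') {v : M → ℝ}
    (hv : ∀ a ∉ e.source, v a = 0) (hv' : ∀ a ∉ e'.source, v a = 0) :
    ∫ p in e.target, v (e.symm p) * volDensity φ e p
      = ∫ p in e'.target, v (e'.symm p) * volDensity φ e' p := by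
  -- Only the overlap of the charts contributes, and there the absolute Jacobian of the change of
  -- variables is the ratio of the two densities.
  set U := e.target ∩ e.symm ⁻¹' e'.source
  set U' := e'.target ∩ e'.symm ⁻¹' e.source
  have hU : IsOpen U := e.isOpen_inter_preimage_symm e'.open_source
  have himg : transition e e' '' U = U' := by
    ext q
    constructor
    · rintro ⟨p, hp, rfl⟩
      refine ⟨transition_mem_target hp.2, ?_⟩
      rw [mem_preimage, symm_transition hp.2]
      exact e.map_target hp.1
    · intro hq
      refine ⟨transition e' e q, ⟨transition_mem_target hq.2, ?_⟩,
        transition_transition hq.1 hq.2⟩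
      rw [mem_preimage, symm_transition hq.2]
      exact e'.map_target hq.1
  have hinj : InjOn (transition e e') U := fun p hp q hq hpq => by
    rw [← transition_transition hp.1 hp.2, hpq, transition_transition hq.1 hq.2]
  have h1 : ∫ p in e.target, v (e.symm p) * volDensity φ e p
      = ∫ p in U, v (e.symm p) * volDensity φ e p := by
    refine setIntegral_eq_of_subset_of_forall_sdiff_eq_zero e.open_target.measurableSet
      inter_subset_left fun p hp => ?_
    rw [hv' _ fun h => hp.2 ⟨hp.1, h⟩, zero_mul]
  have h2 : ∫ p in e'.target, v (e'.symm p) * volDensity φ e' p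
      = ∫ p in U', v (e'.symm p) * volDensity φ e' p := by
    refine setIntegral_eq_of_subset_of_forall_sdiff_eq_zero e'.open_target.measurableSet
      inter_subset_left fun p hp => ?_
    rw [hv _ fun h => hp.2 ⟨hp.1, h⟩, zero_mul]
  rw [h1, h2, ← himg, integral_image_eq_integral_abs_det_fderiv_smul volume hU.measurableSet
    (fun p hp => (hasFDerivAt_transition he he' hp.1 hp.2).hasFDerivWithinAt) hinj]
  refine setIntegral_congr_fun hU.measurableSet fun p hp => ?_
  simp only [smul_eq_mul]
  rw [symm_transition hp.2, volDensity_transition φ he he' hp.1 hp.2]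
  ring

/-- The function `u` on the target of the chart `e` vanishes off the support of `r`. -/
def VanishesOff (r : M → ℝ) (e : OpenPartialHomeomorph M (Eu m)) (u : Eu m → ℝ) : Prop :=
  ∀ q ∈ e.target, e.symm q ∉ tsupport r → u q = 0

theorem vanishesOff_comp_symm (r : M → ℝ) (e : OpenPartialHomeomorph M (Eu m)) :
    VanishesOff r e (fun q => r (e.symm q)) := fun _ _ hq => image_eq_zero_of_notMem_tsupport hq

theorem VanishesOff.mul_right {u : Eu m → ℝ} (hu : VanishesOff r e u) (w : Eu m → ℝ) :
    VanishesOff r e (fun q => u q * w q) := fun q hq hr => by simp [hu q hq hr]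

theorem contDiffAt_comp_symm (he : IsChart e) (hrs : ContMDiff (𝓡 m) 𝓘(ℝ, ℝ) ∞ r) {q : Eu m}
    (hq : q ∈ e.target) : ContDiffAt ℝ ∞ (fun q => r (e.symm q)) q :=
  (hrs.contMDiffAt.comp q (he.contMDiffAt_symm hq)).contDiffAt

variable [CompactSpace M]

theorem isCompact_image_tsupport (hr : tsupport r ⊆ e.source) : IsCompact (e '' tsupport r) :=
  (isClosed_tsupport r).isCompact.image_of_continuousOn (e.continuousOn.mono hr)

theorem image_tsupport_subset (hr : tsupport r ⊆ e.source) : e '' tsupport r ⊆ e.target := by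
  rintro _ ⟨a, ha, rfl⟩
  exact e.map_source (hr ha)

theorem VanishesOff.eq_zero {u : Eu m → ℝ} (hu : VanishesOff r e u) {q : Eu m}
    (hq : q ∈ e.target) (hq' : q ∉ e '' tsupport r) : u q = 0 :=
  hu q hq fun h => hq' ⟨_, h, e.right_inv hq⟩

theorem VanishesOff.integrableOn {u : Eu m → ℝ} (hu : VanishesOff r e u)
    (hr : tsupport r ⊆ e.source) (hc : ContinuousOn u e.target) : IntegrableOn u e.target :=
  ((hc.mono (image_tsupport_subset hr)).integrableOn_compact
    (isCompact_image_tsupport hr)).of_forall_sdiff_eq_zero e.open_target.measurableSet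
    fun _ hq => hu.eq_zero hq.1 hq.2

/-- The complement of the closed support is open, so vanishing there passes to derivatives. -/
theorem VanishesOff.partialD {u : Eu m → ℝ} (hu : VanishesOff r e u) (α : Fin m) :
    VanishesOff r e (partialD α u) := by
  intro q hq hqr
  have h : u =ᶠ[nhds q] fun _ => 0 := by
    filter_upwards [e.open_target.mem_nhds hq, (e.continuousAt_symm hq).preimage_mem_nhds
      ((isClosed_tsupport r).isOpen_compl.mem_nhds hqr)] with y hy hy' using hu y hy hy'
  rw [partialD_eq, h.fderiv_eq]
  simp

/-- The integral of a partial derivative of a function with compact support is zero. -/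
theorem VanishesOff.integral_partialD [T2Space M] {u : Eu m → ℝ} (hu : VanishesOff r e u)
    (hr : tsupport r ⊆ e.source) (hc : ∀ q ∈ e.target, ContDiffAt ℝ ∞ u q) (α : Fin m) :
    ∫ q in e.target, LagrangeHarmonic.partialD α u q = 0 := by
  -- Extension by zero is differentiable on all of `ℝᵐ`: the support of `r` has compact, hence
  -- closed, image inside the target, so every point outside the target has a neighbourhood where
  -- `w` is zero.
  set w : Eu m → ℝ := e.target.indicator u
  have hK := isCompact_image_tsupport hr
  have h1 : ∀ q ∈ e.target, w =ᶠ[nhds q] u := fun q hq => by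
    filter_upwards [e.open_target.mem_nhds hq] with y hy using indicator_of_mem hy u
  have h0 : ∀ q ∉ e.target, w =ᶠ[nhds q] fun _ => 0 := fun q hq => by
    filter_upwards [hK.isClosed.isOpen_compl.mem_nhds
      (fun h => hq (image_tsupport_subset hr h))] with y hy
    by_cases hyt : y ∈ e.target
    · exact (indicator_of_mem hyt u).trans (hu.eq_zero hyt hy)
    · exact indicator_of_notMem hyt u
  have hw : ∀ q, DifferentiableAt ℝ w q := fun q => by
    by_cases hq : q ∈ e.target
    · exact ((hc q hq).differentiableAt (by simp)).congr_of_eventuallyEq (h1 q hq)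
    · exact (differentiableAt_const 0).congr_of_eventuallyEq (h0 q hq)
  have hd : (fun q => fderiv ℝ w q (stdVec α))
      = e.target.indicator (LagrangeHarmonic.partialD α u) := by
    funext q
    by_cases hq : q ∈ e.target
    · rw [indicator_of_mem hq, (h1 q hq).fderiv_eq, partialD_eq]
    · rw [indicator_of_notMem hq, (h0 q hq).fderiv_eq]
      simp
  have hi : Integrable w := (integrable_indicator_iff e.open_target.measurableSet).2
    (hu.integrableOn hr fun q hq => (hc q hq).continuousAt.continuousWithinAt)
  have hi' : Integrable (fun q => fderiv ℝ w q (stdVec α)) := by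
    rw [hd]
    exact (integrable_indicator_iff e.open_target.measurableSet).2
      ((hu.partialD α).integrableOn hr fun q hq =>
        (contDiffAt_partialD (hc q hq) α).continuousAt.continuousWithinAt)
  -- Integration by parts against the constant function `1`.
  have h := integral_mul_fderiv_eq_neg_fderiv_mul_of_integrable (μ := volume)
    (f := fun _ : Eu m => (1 : ℝ)) (g := w) (v := stdVec α) (by simp) (by simpa using hi')
    (by simpa using hi) (fun _ _ => differentiableAt_const _) (fun q _ => hw q)
  rw [← integral_indicator e.open_target.measurableSet, ← hd]
  simpa using h

/-- Integration by parts against a function with support in the domain of a chart. -/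
theorem integral_mul_sum_partialD [T2Space M] (he : IsChart e)
    (hrs : ContMDiff (𝓡 m) 𝓘(ℝ, ℝ) ∞ r) (hr : tsupport r ⊆ e.source) {w : Fin m → Eu m → ℝ}
    (hw : ∀ α, ∀ q ∈ e.target, ContDiffAt ℝ ∞ (w α) q) :
    ∫ q in e.target, r (e.symm q) * ∑ α, partialD α (w α) q
      = -∫ q in e.target, ∑ α, partialD α (fun q => r (e.symm q)) q * w α q := by
  have hv := vanishesOff_comp_symm r e
  have hc := fun q (hq : q ∈ e.target) => contDiffAt_comp_symm he hrs hq
  have hi1 : ∀ α, IntegrableOn (fun q => r (e.symm q) * partialD α (w α) q) e.target := fun α =>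
    (hv.mul_right _).integrableOn hr fun q hq =>
      ((hc q hq).mul (contDiffAt_partialD (hw α q hq) α)).continuousAt.continuousWithinAt
  have hi2 : ∀ α, IntegrableOn (fun q => partialD α (fun q => r (e.symm q)) q * w α q)
      e.target := fun α => ((hv.partialD α).mul_right _).integrableOn hr fun q hq =>
      ((contDiffAt_partialD (hc q hq) α).mul (hw α q hq)).continuousAt.continuousWithinAt
  simp only [Finset.mul_sum]
  rw [integral_finsetSum _ fun α _ => hi1 α, integral_finsetSum _ fun α _ => hi2 α,
    ← Finset.sum_neg_distrib]
  refine Finset.sum_congr rfl fun α _ => ?_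
  have h := (hv.mul_right (w α)).integral_partialD hr (fun q hq => (hc q hq).mul (hw α q hq)) α
  rw [eq_neg_iff_add_eq_zero, ← integral_add (hi1 α) (hi2 α), ← h]
  refine setIntegral_congr_fun e.open_target.measurableSet fun q hq => ?_
  rw [partialD_mul ((hc q hq).differentiableAt (by simp)) ((hw α q hq).differentiableAt (by simp))]
  ring

/-- Differentiation under the integral sign, for functions with compact support. -/
theorem hasDerivAt_integral_chart (hr : tsupport r ⊆ e.source)
    (hrc : ContinuousOn (fun q => r (e.symm q)) e.target) {U : ℝ × Eu m → ℝ} {s : Eu m → ℝ}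
    (hU : ∀ z : ℝ × Eu m, z.2 ∈ e.target → ContDiffAt ℝ ∞ U z) (hs : ContinuousOn s e.target) :
    HasDerivAt (fun t => ∫ q in e.target, r (e.symm q) * U (t, q) * s q)
      (∫ q in e.target, r (e.symm q) * deriv (fun t => U (t, q)) 0 * s q) 0 := by
  have hv := vanishesOff_comp_symm r e
  have hm := e.open_target.measurableSet
  set U' : ℝ × Eu m → ℝ := fun z => fderiv ℝ U z (1, 0)
  have hUd : ∀ t, ∀ q ∈ e.target, HasDerivAt (fun t => U (t, q)) (U' (t, q)) t := by
    intro t q hq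
    have h1 : HasFDerivAt U (fderiv ℝ U (t, q)) (t, q) :=
      ((hU (t, q) hq).differentiableAt (by simp)).hasFDerivAt
    have h2 := (h1.comp t (hasFDerivAt_prodMk_left (𝕜 := ℝ) t q)).hasDerivAt
    simp only [ContinuousLinearMap.comp_apply, ContinuousLinearMap.inl_apply] at h2
    exact h2
  have hUc : ∀ t, ContinuousOn (fun q => U (t, q)) e.target := fun t q hq =>
    ((hU (t, q) hq).continuousAt.comp
      (hasFDerivAt_prodMk_right (𝕜 := ℝ) t q).continuousAt).continuousWithinAt
  have hU'c : ∀ z : ℝ × Eu m, z.2 ∈ e.target → ContinuousAt U' z := fun z hz =>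
    (((hU z hz).fderiv_right (m := ∞) (by simp)).clm_apply contDiffAt_const).continuousAt
  have hF : ∀ t, ContinuousOn (fun q => r (e.symm q) * U (t, q) * s q) e.target :=
    fun t => (hrc.mul (hUc t)).mul hs
  have hF' : ContinuousOn (fun q => r (e.symm q) * U' (0, q) * s q) e.target :=
    (hrc.mul fun q hq => ((hU'c (0, q) hq).comp
      (hasFDerivAt_prodMk_right (𝕜 := ℝ) (0 : ℝ) q).continuousAt).continuousWithinAt).mul hs
  have hK := isCompact_image_tsupport hr
  have hKt := image_tsupport_subset hr
  -- The dominating function is a constant on the compact image of the support and zero elsewhere;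
  -- the constant bounds the time derivative for `|t| ≤ 1`, which covers the unit ball used below.
  obtain ⟨C, hC⟩ := ((isCompact_Icc (a := (-1 : ℝ)) (b := 1)).prod hK).exists_bound_of_continuousOn
    (f := fun z : ℝ × Eu m => r (e.symm z.2) * U' z * s z.2) (by
      have hsnd : MapsTo (Prod.snd : ℝ × Eu m → Eu m)
        (Icc (-1 : ℝ) 1 ×ˢ (e '' tsupport r)) e.target := fun z hz => hKt hz.2
      exact ((hrc.comp continuousOn_snd hsnd).mul fun z hz =>
        (hU'c z (hKt hz.2)).continuousWithinAt).mul (hs.comp continuousOn_snd hsnd))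
  have hCi : IntegrableOn ((e '' tsupport r).indicator fun _ => C) e.target :=
    ((integrable_indicator_iff hK.measurableSet).2
      (integrableOn_const hK.measure_lt_top.ne)).integrableOn
  have hd := hasDerivAt_integral_of_dominated_loc_of_deriv_le (μ := volume.restrict e.target)
    (F := fun t q => r (e.symm q) * U (t, q) * s q)
    (F' := fun t q => r (e.symm q) * U' (t, q) * s q) (x₀ := (0 : ℝ))
    (Metric.ball_mem_nhds 0 one_pos)
    (Filter.Eventually.of_forall fun t => (hF t).aestronglyMeasurable hm)
    (((hv.mul_right _).mul_right _).integrableOn hr (hF 0)) (hF'.aestronglyMeasurable hm)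
    (bound := (e '' tsupport r).indicator fun _ => C) (ae_restrict_of_forall_mem hm ?_) hCi
    (ae_restrict_of_forall_mem hm ?_)
  · refine hd.2.congr_deriv (setIntegral_congr_fun hm fun q hq => ?_)
    simp only [(hUd 0 q hq).deriv]
  · intro q hq t ht
    by_cases hqK : q ∈ e '' tsupport r
    · rw [indicator_of_mem hqK]
      rw [Real.ball_eq_Ioo] at ht
      exact hC (t, q) ⟨⟨by linarith [ht.1], by linarith [ht.2]⟩, hqK⟩
    · rw [indicator_of_notMem hqK, hv.eq_zero hq hqK]
      simp
  · intro q hq t _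
    exact ((hUd t q hq).const_mul _).mul_const _

end Integration

/-! ### Globalization by the partition of unity and the vanishing first variation. -/

section FirstVariation

open MeasureTheory

variable {m n : ℕ} {M : Type*} [TopologicalSpace M] [ChartedSpace (Eu m) M]
  [IsManifold (𝓡 m) ∞ M] {N : Type*} [TopologicalSpace N] [ChartedSpace (Eu n) N]
  [IsManifold (𝓡 n) ∞ N] {e : OpenPartialHomeomorph M (Eu m)} {p : Eu m}
  {F : ℝ → M → N}

/-- The derivative of the real function `r`. -/
def scalarDeriv (r : M → ℝ) (a : M) : Eu m →L[ℝ] ℝ := mfderiv (𝓡 m) 𝓘(ℝ, ℝ) r a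

/-- The function `g^{αβ} r_α h(W, f_β)`, where `W` is the variation field. -/
def dirFlux (g : RMetric m M) (h : RMetric n N) (F : ℝ → M → N) (r : M → ℝ) (a : M) : ℝ :=
  ∑ α, ∑ β, (gramMatrix g a)⁻¹ α β * (scalarDeriv r a (stdVec α)
    * innerForm h (F 0 a) (varField F a) (mapDeriv (F 0) a (stdVec β)))

/-- This is the `g`-trace of the bilinear form `dr ⊗ h(W, df)`, hence the same in every frame; a
function on `M` can then be carried between charts. -/
theorem dirFlux_eq (g : RMetric m M) (h : RMetric n N) (F : ℝ → M → N) {r : M → ℝ}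
    (hr : ContMDiff (𝓡 m) 𝓘(ℝ, ℝ) ∞ r) (he : IsChart e) (hp : p ∈ e.target) :
    dirFlux g h F r (e.symm p)
      = ∑ α, partialD α (fun q => r (e.symm q)) p * flux g h F e α p := by
  have h0 : (∞ : WithTop ℕ∞) ≠ 0 := by simp
  have h1 := sum_gramMatrix_inv g he hp
    ((scalarDeriv r (e.symm p)).smulRight
      ((innerForm h (F 0 (e.symm p)) (varField F (e.symm p))).comp (mapDeriv (F 0) (e.symm p))))
  have h2 : mfderiv (𝓡 m) 𝓘(ℝ, ℝ) (r ∘ e.symm) p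
      = (mfderiv (𝓡 m) 𝓘(ℝ, ℝ) r (e.symm p)).comp (mfderiv (𝓡 m) (𝓡 m) e.symm p) :=
    mfderiv_comp p (hr.contMDiffAt.mdifferentiableAt h0)
      ((he.contMDiffAt_symm hp).mdifferentiableAt h0)
  have h3 : mfderiv (𝓡 m) 𝓘(ℝ, ℝ) (r ∘ e.symm) p = fderiv ℝ (r ∘ e.symm) p := mfderiv_eq_fderiv
  have h4 : ∀ α, scalarDeriv r (e.symm p)
      (chartFrame e p (stdVec α)) = partialD α (fun q => r (e.symm q)) p := fun α =>
    (congrArg (fun L : Eu m →L[ℝ] ℝ => L (stdVec α)) (h3.symm.trans h2)).symm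
  refine Eq.trans rfl (h1.trans ?_)
  refine Finset.sum_congr rfl fun α _ => ?_
  rw [flux, Finset.mul_sum]
  refine Finset.sum_congr rfl fun β _ => ?_
  rw [ContinuousLinearMap.smulRight_apply, h4, _root_.smul_apply, smul_eq_mul]
  simp only [ContinuousLinearMap.comp_apply]
  ring

theorem dirFlux_eq_zero (g : RMetric m M) (h : RMetric n N) (F : ℝ → M → N) {r : M → ℝ} {a : M}
    (ha : a ∉ tsupport r) : dirFlux g h F r a = 0 := by
  have h1 : r =ᶠ[nhds a] fun _ => 0 := notMem_tsupport_iff_eventuallyEq.1 ha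
  have h2 : mfderiv (𝓡 m) 𝓘(ℝ, ℝ) r a = 0 := h1.mfderiv_eq.trans mfderiv_const
  have h3 : scalarDeriv (m := m) r a = 0 := h2
  simp [dirFlux, h3]

theorem contDiffAt_dirFlux (g : RMetric m M) (h : RMetric n N) (hF : SmoothVariation m n F)
    {r : M → ℝ} (hr : ContMDiff (𝓡 m) 𝓘(ℝ, ℝ) ∞ r) (he : IsChart e) (hp : p ∈ e.target) :
    ContDiffAt ℝ ∞ (fun q => dirFlux g h F r (e.symm q)) p := by
  have h1 : ContDiffAt ℝ ∞
      (fun q => ∑ α, partialD α (fun q => r (e.symm q)) q * flux g h F e α q) p :=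
    ContDiffAt.sum fun α _ => (contDiffAt_partialD (contDiffAt_comp_symm he hr hp) α).mul
      (contDiffAt_flux g h hF he hp α)
  refine h1.congr_of_eventuallyEq ?_
  filter_upwards [e.open_target.mem_nhds hp] with q hq using dirFlux_eq g h F hr he hq

/-- The expression is linear in `dr`, and the differentials of functions with constant sum add up to
zero. -/
theorem sum_dirFlux_eq_zero (g : RMetric m M) (h : RMetric n N) (F : ℝ → M → N) {ι : Type*}
    {S : Finset ι} {r : ι → M → ℝ} (hr : ∀ i, ContMDiff (𝓡 m) 𝓘(ℝ, ℝ) ∞ (r i))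
    (hsum : ∀ a, ∑ i ∈ S, r i a = 1) (a : M) : ∑ i ∈ S, dirFlux g h F (r i) a = 0 := by
  have he := isChart_chartAt (m := m) a
  set e := chartAt (Eu m) a
  have hp : e a ∈ e.target := e.map_source (mem_chart_source _ a)
  rw [← e.left_inv (mem_chart_source _ a)]
  simp only [fun i => dirFlux_eq g h F (hr i) he hp]
  rw [Finset.sum_comm]
  refine Finset.sum_eq_zero fun α _ => ?_
  have h1 : ∑ i ∈ S, partialD α (fun q => r i (e.symm q)) (e a) = 0 := by
    have h2 : fderiv ℝ (fun q => ∑ i ∈ S, r i (e.symm q)) (e a) = 0 := by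
      simp only [hsum]
      simp
    rw [fderiv_fun_sum fun i _ =>
      (contDiffAt_comp_symm he (hr i) hp).differentiableAt (by simp)] at h2
    have h3 := congrArg (fun L : Eu m →L[ℝ] ℝ => L (stdVec α)) h2
    simpa [partialD_eq] using h3
  rw [← Finset.sum_mul, h1, zero_mul]

variable [T2Space M] [CompactSpace M]

variable (m M) in
theorem finite_support_partitionOfUnity :
    {x : M | (Function.support (partitionOfUnity m M x)).Nonempty}.Finite :=
  (partitionOfUnity m M).locallyFinite.finite_nonempty_of_compact

variable (m M) in
/-- The finite set of the indices of the nonzero functions of the partition of unity. -/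
def indexSet : Finset M := (finite_support_partitionOfUnity m M).toFinset

theorem partitionOfUnity_eq_zero {x : M} (hx : x ∉ indexSet m M) (a : M) :
    partitionOfUnity m M x a = 0 := by
  by_contra h
  exact hx ((Finite.mem_toFinset _).2 ⟨a, h⟩)

theorem sum_partitionOfUnity (a : M) : ∑ x ∈ indexSet m M, partitionOfUnity m M x a = 1 := by
  rw [← (partitionOfUnity m M).sum_eq_one (mem_univ a)]
  refine (finsum_eq_sum_of_support_subset _ fun x hx => ?_).symm
  by_contra h
  exact hx (partitionOfUnity_eq_zero h a)

/-- The index set does not depend on `u`, so the energies of all maps in a variation are sums over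
the same finite set and can be differentiated termwise. -/
theorem volIntegral_eq_sum (φ : RMetric m M) (u : M → ℝ) :
    volIntegral φ u = ∑ x ∈ indexSet m M, ∫ p in (chartAt (Eu m) x).target,
      partitionOfUnity m M x ((chartAt (Eu m) x).symm p) * u ((chartAt (Eu m) x).symm p)
        * volDensity φ (chartAt (Eu m) x) p := by
  refine finsum_eq_sum_of_support_subset _ fun x hx => ?_
  by_contra h
  exact hx (by simp [partitionOfUnity_eq_zero h])

theorem contMDiff_partitionOfUnity (x : M) :
    ContMDiff (𝓡 m) 𝓘(ℝ, ℝ) ∞ (partitionOfUnity m M x : M → ℝ) :=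
  (partitionOfUnity m M x).contMDiff

theorem tsupport_partitionOfUnity (x : M) :
    tsupport (partitionOfUnity m M x) ⊆ (chartAt (Eu m) x).source :=
  partitionOfUnity_isSubordinate m M x

/-- Integrals in different charts cancel when the sum of the integrands is zero. -/
theorem sum_integral_chart_eq_zero (φ : RMetric m M) {S : Finset M} {ρ u : M → M → ℝ}
    (hsupp : ∀ x, tsupport (ρ x) ⊆ (chartAt (Eu m) x).source)
    (hρ : ∀ x, ContMDiff (𝓡 m) 𝓘(ℝ, ℝ) ∞ (ρ x)) (hsum : ∀ a, ∑ x ∈ S, ρ x a = 1)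
    (hu : ∀ x, ∀ a ∉ tsupport (ρ x), u x a = 0) (husum : ∀ a, ∑ x ∈ S, u x a = 0)
    (huc : ∀ x y, ContinuousOn (fun p => u x ((chartAt (Eu m) y).symm p))
      (chartAt (Eu m) y).target) :
    ∑ x ∈ S, ∫ p in (chartAt (Eu m) x).target,
      u x ((chartAt (Eu m) x).symm p) * volDensity φ (chartAt (Eu m) x) p = 0 := by
  have hc : ∀ x y z, ContinuousOn (fun p => ρ y ((chartAt (Eu m) z).symm p)
      * u x ((chartAt (Eu m) z).symm p) * volDensity φ (chartAt (Eu m) z) p)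
      (chartAt (Eu m) z).target := fun x y z =>
    (ContinuousOn.mul (fun p hp => (contDiffAt_comp_symm (isChart_chartAt z) (hρ y)
      hp).continuousAt.continuousWithinAt) (huc x z)).mul fun p hp =>
      (contDiffAt_volDensity φ (isChart_chartAt z) hp).continuousAt.continuousWithinAt
  -- Inserting `∑ ρ y = 1` produces pieces `ρ y * u x` supported in both chart domains. Each can be
  -- moved to the chart at `y`, where the sum over `x` vanishes under a single integral.
  have h1 : ∀ x, ∫ p in (chartAt (Eu m) x).target,
      u x ((chartAt (Eu m) x).symm p) * volDensity φ (chartAt (Eu m) x) p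
      = ∑ y ∈ S, ∫ p in (chartAt (Eu m) x).target, ρ y ((chartAt (Eu m) x).symm p)
        * u x ((chartAt (Eu m) x).symm p) * volDensity φ (chartAt (Eu m) x) p := by
    intro x
    rw [← integral_finsetSum _ fun y _ => ?_]
    · refine congrArg _ (funext fun p => ?_)
      rw [← Finset.sum_mul, ← Finset.sum_mul, hsum, one_mul]
    · have hv : VanishesOff (ρ x) (chartAt (Eu m) x) fun p => ρ y ((chartAt (Eu m) x).symm p)
          * u x ((chartAt (Eu m) x).symm p) * volDensity φ (chartAt (Eu m) x) p :=
        fun q _ hq => by simp [hu x _ hq]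
      exact hv.integrableOn (hsupp x) (hc x y x)
  have h2 : ∀ x y, ∫ p in (chartAt (Eu m) x).target, ρ y ((chartAt (Eu m) x).symm p)
        * u x ((chartAt (Eu m) x).symm p) * volDensity φ (chartAt (Eu m) x) p
      = ∫ p in (chartAt (Eu m) y).target, ρ y ((chartAt (Eu m) y).symm p)
        * u x ((chartAt (Eu m) y).symm p) * volDensity φ (chartAt (Eu m) y) p := fun x y =>
    integral_chart_eq φ (isChart_chartAt x) (isChart_chartAt y) (v := fun a => ρ y a * u x a)
      (fun a ha => by rw [hu x a fun h => ha (hsupp x h), mul_zero])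
      (fun a ha => by
        rw [image_eq_zero_of_notMem_tsupport fun h => ha (hsupp y h), zero_mul])
  rw [Finset.sum_congr rfl fun x _ => (h1 x).trans (Finset.sum_congr rfl fun y _ => h2 x y),
    Finset.sum_comm]
  refine Finset.sum_eq_zero fun y _ => ?_
  rw [← integral_finsetSum _ fun x _ => ?_]
  · refine (congrArg _ (funext fun p => ?_)).trans (integral_zero' _ _)
    rw [← Finset.sum_mul, ← Finset.mul_sum, husum, mul_zero, zero_mul]
    rfl
  · exact (((vanishesOff_comp_symm (ρ y) _).mul_right _).mul_right _).integrableOn (hsupp y)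
      (hc x y y)

/-- The divergence theorem, for the vector field `g^{αβ} h(W, f_β)`. -/
theorem sum_integral_dirFlux (g φ : RMetric m M) (h : RMetric n N) (hF : SmoothVariation m n F) :
    ∑ x ∈ indexSet m M, ∫ p in (chartAt (Eu m) x).target,
      dirFlux g h F (partitionOfUnity m M x) ((chartAt (Eu m) x).symm p)
        * volDensity φ (chartAt (Eu m) x) p = 0 :=
  sum_integral_chart_eq_zero φ (ρ := fun x => partitionOfUnity m M x)
    (u := fun x => dirFlux g h F (partitionOfUnity m M x)) tsupport_partitionOfUnity
    contMDiff_partitionOfUnity sum_partitionOfUnity (fun _ _ ha => dirFlux_eq_zero g h F ha)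
    (sum_dirFlux_eq_zero g h F contMDiff_partitionOfUnity sum_partitionOfUnity)
    fun x y _ hp => (contDiffAt_dirFlux g h hF (contMDiff_partitionOfUnity x)
      (isChart_chartAt y) hp).continuousAt.continuousWithinAt

/-- The first variation of the energy vanishes at a map with zero tension field. -/
theorem isHarmonic_of_tension_eq_zero (g φ : RMetric m M) (h : RMetric n N) {f : M → N}
    (hf : ContMDiff (𝓡 m) (𝓡 n) ∞ f)
    (ht : ∀ e : OpenPartialHomeomorph M (Eu m), IsChart e →
      ∀ e' : OpenPartialHomeomorph N (Eu n), IsChart e' →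
        ∀ p ∈ e.target, f (e.symm p) ∈ e'.source → tension g φ h e e' f p = 0) :
    IsHarmonic g φ h f := by
  refine ⟨hf, fun F hF hF0 => ?_⟩
  replace hF : SmoothVariation m n F := hF
  subst hF0
  have hd : ∀ x : M, HasDerivAt (fun t => ∫ p in (chartAt (Eu m) x).target,
      partitionOfUnity m M x ((chartAt (Eu m) x).symm p)
        * energyDensity g h (F t) ((chartAt (Eu m) x).symm p)
        * volDensity φ (chartAt (Eu m) x) p)
      (∫ p in (chartAt (Eu m) x).target, partitionOfUnity m M x ((chartAt (Eu m) x).symm p)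
        * deriv (fun t => energyDensity g h (F t) ((chartAt (Eu m) x).symm p)) 0
        * volDensity φ (chartAt (Eu m) x) p) 0 := fun x =>
    hasDerivAt_integral_chart (r := partitionOfUnity m M x) (tsupport_partitionOfUnity x)
      (fun q hq => (contDiffAt_comp_symm (isChart_chartAt x) (contMDiff_partitionOfUnity x)
        hq).continuousAt.continuousWithinAt)
      (U := fun z => energyDensity g h (F z.1) ((chartAt (Eu m) x).symm z.2))
      (fun z hz => contDiffAt_energyDensity g h hF (isChart_chartAt x) hz)
      (fun q hq => (contDiffAt_volDensity φ (isChart_chartAt x)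
        hq).continuousAt.continuousWithinAt)
  have hE : (fun t => energy g φ h (F t)) = fun t => (1 / 2) * ∑ x ∈ indexSet m M,
      ∫ p in (chartAt (Eu m) x).target, partitionOfUnity m M x ((chartAt (Eu m) x).symm p)
        * energyDensity g h (F t) ((chartAt (Eu m) x).symm p)
        * volDensity φ (chartAt (Eu m) x) p := by
    funext t
    rw [energy, volIntegral_eq_sum]
  rw [hE]
  refine ((HasDerivAt.fun_sum fun x _ => hd x).const_mul (1 / 2)).congr_deriv ?_
  -- Integration by parts introduces a sign, so it is the negative of the derivative that matches
  -- the sum of the `dirFlux` integrals term by term.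
  rw [Finset.mul_sum, ← neg_eq_zero, ← Finset.sum_neg_distrib]
  refine (Finset.sum_congr rfl fun x _ => ?_).trans (sum_integral_dirFlux g φ h hF)
  have he := isChart_chartAt (m := m) x
  set e := chartAt (Eu m) x
  have hm := e.open_target.measurableSet
  have h1 := integral_mul_sum_partialD he (contMDiff_partitionOfUnity x)
    (tsupport_partitionOfUnity x) (w := fun α q => volDensity φ e q * flux g h F e α q)
    fun α q hq => (contDiffAt_volDensity φ he hq).mul (contDiffAt_flux g h hF he hq α)
  rw [← integral_const_mul, neg_eq_iff_eq_neg]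
  refine Eq.trans ?_ (h1.trans (congrArg Neg.neg ?_))
  · refine setIntegral_congr_fun hm fun q hq => ?_
    -- The identity is pointwise and its two sides do not involve the chart of `N`, so that chart
    -- may be chosen afresh at each `q`.
    rw [sum_partialD_flux g φ h hF he (isChart_chartAt _) hq (mem_chart_source (Eu n) _)
      (ht e he _ (isChart_chartAt _) q hq (mem_chart_source (Eu n) _))]
    ring
  · refine setIntegral_congr_fun hm fun q hq => ?_
    rw [dirFlux_eq g h F (contMDiff_partitionOfUnity x) he hq, Finset.sum_mul]
    exact Finset.sum_congr rfl fun α _ => by ring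

end FirstVariation

end LagrangeHarmonic

end

theorem mainTheorem1 {m n : ℕ}
    {M : Type*} [TopologicalSpace M] [ChartedSpace (LagrangeHarmonic.Eu m) M]
    [IsManifold (𝓡 m) ∞ M] [T2Space M] [CompactSpace M]
    {N : Type*} [TopologicalSpace N] [ChartedSpace (LagrangeHarmonic.Eu n) N]
    [IsManifold (𝓡 n) ∞ N]
    (LM : LagrangeHarmonic.ElectrodynamicsSpace m M)
    (LN : LagrangeHarmonic.ElectrodynamicsSpace n N)
    (φ : LagrangeHarmonic.RMetric m M)
    (f : M → N) (hf : ContMDiff (𝓡 m) (𝓡 n) ∞ f)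
    (hgeo : ∀ (J : Set ℝ) (c : ℝ → M), IsOpen J → J.OrdConnected →
      LagrangeHarmonic.IsPairGeodesic LM.metric φ c J →
      LagrangeHarmonic.IsGeodesic LN.metric (f ∘ c) J) :
    LagrangeHarmonic.HarmonicMapEquations LM.metric φ LN.metric f ∧
      LagrangeHarmonic.IsHarmonic LM.metric φ LN.metric f :=
  ⟨LagrangeHarmonic.harmonicMapEquations_of_geodesic _ _ _ hf hgeo,
    LagrangeHarmonic.isHarmonic_of_tension_eq_zero _ _ _ hf fun _ he _ he' _ hp hfp =>
      LagrangeHarmonic.tension_eq_zero _ _ _ hf hgeo he he' hp hfp⟩
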